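/- Let $R$ be an associative unital ring, not necessarily commutative. An $R$-ring is an $R$-bimodule with an associative, $R$-balanced, $R$-bilinear multiplication (not necessarily with unity). An $R$-coring $(\mathcal C,\Delta,\varepsilon)$ is an $R$-bimodule with $R$-bilinear maps $\Delta:\mathcal C\to\mathcal C\otimes_R\mathcal C$, $\Delta(c)=\sum c_1\otimes c_2$, and $\varepsilon:\mathcal C\to R$ that are coassociative and counital. Its dual $R$-rings are ${}^*\mathcal C=\mathrm{Hom}_{R-}(\mathcal C,R)$ with $(f\star g)(c)=\sum g(c_1f(c_2))$, $(rf)(c)=f(cr)$, $(fr)(c)=f(c)r$, and $\mathcal C^*=\mathrm{Hom}_{-R}(\mathcal C,R)$ with $(f\star g)(c)=\sum f(g(c_1)c_2)$, $(rf)(c)=rf(c)$, $(fr)(c)=f(rc)$; both carry the finite topology, induced from the product topology on $R^{\mathcal C}$ with $R$ discrete. A measuring left $R$-pairing $P=(\mathcal A,\mathcal C)$ is an $R$-ring $\mathcal A$ and an $R$-coring $\mathcal C$ with an $R$-bilinear multiplicative map $\kappa_P:\mathcal A\to{}^*\mathcal C$, $\langle a,c\rangle:=\kappa_P(a)(c)$.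 A measuring right $R$-pairing $Q=(\mathcal B,\mathcal D)$ is defined likewise with $\kappa_Q:\mathcal B\to\mathcal D^*$. A module $W$ is locally projective if for every surjection $\pi:L\to N$, every $g:W\to N$ and every finitely generated submodule $F\subseteq W$ there is $g':W\to L$ with $\pi g'|_F=g|_F$. A $(\mathcal D,\mathcal C)$-bicomodule is an $R$-bimodule $M$ with coassociative $R$-bilinear coactions $M\to M\otimes_R\mathcal C$, $m\mapsto\sum m_{<0>}\otimes m_{<1>}$, and $M\to\mathcal D\otimes_RM$, $m\mapsto\sum m_{<-1>}\otimes m_{<0>}$, each colinear for the other; it is counital if both coactions are injective. Let ${}^{\mathcal D}\mathcal M^{\mathcal C}$ be the category of counital $(\mathcal D,\mathcal C)$-bicomodules and bicolinear maps. A $(\mathcal B,\mathcal A)$-bimodule is an $R$-bimodule $M$ with associative, $R$-balanced, $R$-bilinear actions of $\mathcal B$ on the left and $\mathcal A$ on the right that commute; its morphisms are the $R$-bilinear, $\mathcal B$-linear and $\mathcal A$-linear maps. It is faithful if $ma=0$ for all $a\in\mathcal A$ implies $m=0$, and $bm=0$ for all $b\in\mathcal B$ implies $m=0$; it is unital if $M\mathcal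 A=M$ and $\mathcal BM=M$. It is $(\mathcal D,\mathcal C)$-birational if for every $m\in M$ there are $\sum m_i\otimes c_i\in M\otimes_R\mathcal C$ with $ma=\sum m_i\langle a,c_i\rangle$ for all $a\in\mathcal A$, and $\sum d_j\otimes n_j\in\mathcal D\otimes_RM$ with $bm=\sum\langle b,d_j\rangle n_j$ for all $b\in\mathcal B$. Denote by ${}^{\mathcal D}\mathrm{Rat}^{\mathcal C}({}_{\mathcal B}\widetilde{\mathcal M}_{\mathcal A})$ and ${}^{\mathcal D}\mathrm{Rat}^{\mathcal C}({}_{\mathcal B}\mathcal M_{\mathcal A})$ the full subcategories of the faithful, respectively the unital, $(\mathcal D,\mathcal C)$-birational $(\mathcal B,\mathcal A)$-bimodules. Theorem. Let $P=(\mathcal A,\mathcal C)$ be a measuring left $R$-pairing and $Q=(\mathcal B,\mathcal D)$ a measuring right $R$-pairing ($\mathcal A$, $\mathcal B$ not necessarily with unities). Suppose that $\mathcal C$ is locally projective as a left $R$-module, $\mathcal D$ is locally projective as a right $R$-module, and $\kappa_P(\mathcal A)\subseteq{}^*\mathcal C$ and $\kappa_Q(\mathcal B)\subseteq\mathcal D^*$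 are dense in the finite topologies. Then there are isomorphisms (not merely equivalences) of categories $${}^{\mathcal D}\mathcal M^{\mathcal C}\;\simeq\;{}^{\mathcal D}\mathrm{Rat}^{\mathcal C}({}_{\mathcal B}\widetilde{\mathcal M}_{\mathcal A})={}^{\mathcal D}\mathrm{Rat}^{\mathcal C}({}_{\mathcal B}\mathcal M_{\mathcal A}),\qquad {}^{\mathcal D}\mathcal M^{\mathcal C}\;\simeq\;{}^{\mathcal D}\mathrm{Rat}^{\mathcal C}({}_{\mathcal D^*}\widetilde{\mathcal M}_{{}^*\mathcal C})={}^{\mathcal D}\mathrm{Rat}^{\mathcal C}({}_{\mathcal D^*}\mathcal M_{{}^*\mathcal C}),$$ where the isomorphisms are the identity on underlying $R$-bimodules and on maps, with actions $ma=\sum m_{<0>}\langle a,m_{<1>}\rangle$ and $bm=\sum\langle b,m_{<-1>}\rangle m_{<0>}$, and the second line uses the pairings $({}^*\mathcal C,\mathcal C)$ and $(\mathcal D^*,\mathcal D)$ given by evaluation. -/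

import Mathlib

open MulOpposite

universe u v w

/-! ## Modules and bimodules over a (noncommutative) ring

A left `R`-module is a `Module R`, a right `R`-module is a `Module Rᵐᵒᵖ`, with `m r` written
`op r • m`, and an `R`-bimodule carries both structures together with
`SMulCommClass R Rᵐᵒᵖ M`. Left `R`-linear maps are `M →ₗ[R] N`, right `R`-linear maps are
`M →ₗ[Rᵐᵒᵖ] N`. -/

/-- `R`-bilinear maps (that is, maps of `R`-bimodules). -/
structure BimodMap (R : Type*) [Ring R] (M N : Type*) [AddCommGroup M] [AddCommGroup N]
    [Module R M] [Module Rᵐᵒᵖ M] [Module R N] [Module Rᵐᵒᵖ N] extends M →ₗ[R] N where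
  map_op_smul' : ∀ (r : Rᵐᵒᵖ) (x : M), toFun (r • x) = r • toFun x

namespace BimodMap

variable {R M N L : Type*} [Ring R] [AddCommGroup M] [AddCommGroup N] [AddCommGroup L]
  [Module R M] [Module Rᵐᵒᵖ M] [Module R N] [Module Rᵐᵒᵖ N] [Module R L] [Module Rᵐᵒᵖ L]

instance : FunLike (BimodMap R M N) M N where
  coe f := f.toLinearMap
  coe_injective := by
    rintro ⟨f, hf⟩ ⟨g, hg⟩ h
    have h' : f = g := DFunLike.coe_injective h
    subst h'
    rfl

instance : AddMonoidHomClass (BimodMap R M N) M N where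
  map_add f := f.toLinearMap.map_add
  map_zero f := f.toLinearMap.map_zero

/-- The underlying left linear map. -/
abbrev left (f : BimodMap R M N) : M →ₗ[R] N := f.toLinearMap

/-- The underlying right linear map. -/
def right (f : BimodMap R M N) : M →ₗ[Rᵐᵒᵖ] N where
  toFun := f
  map_add' := f.toLinearMap.map_add
  map_smul' := f.map_op_smul'

@[simp] theorem left_apply (f : BimodMap R M N) (x : M) : f.left x = f x := rfl

@[simp] theorem right_apply (f : BimodMap R M N) (x : M) : f.right x = f x := rfl

@[simp] theorem map_smul_left (f : BimodMap R M N) (r : R) (x : M) : f (r • x) = r • f x :=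
  f.toLinearMap.map_smul r x

@[simp] theorem map_smul_right (f : BimodMap R M N) (r : Rᵐᵒᵖ) (x : M) :
    f (r • x) = r • f x :=
  f.map_op_smul' r x

@[ext] theorem ext {f g : BimodMap R M N} (h : ∀ x, f x = g x) : f = g :=
  DFunLike.ext _ _ h

/-- The identity. -/
def id (R M : Type*) [Ring R] [AddCommGroup M] [Module R M] [Module Rᵐᵒᵖ M] :
    BimodMap R M M where
  toLinearMap := LinearMap.id
  map_op_smul' _ _ := rfl

@[simp] theorem id_apply (x : M) : BimodMap.id R M x = x := rfl

/-- Composition. -/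
def comp (g : BimodMap R N L) (f : BimodMap R M N) : BimodMap R M L where
  toLinearMap := g.toLinearMap ∘ₗ f.toLinearMap
  map_op_smul' r x :=
    (congrArg g (f.map_op_smul' r x)).trans (g.map_op_smul' r (f x))

@[simp] theorem comp_apply (g : BimodMap R N L) (f : BimodMap R M N) (x : M) :
    g.comp f x = g (f x) := rfl

end BimodMap

/-! ## The tensor product over a noncommutative ring -/

open scoped TensorProduct in
/-- The subgroup of `M ⊗[ℤ] N` generated by the elements `(m r) ⊗ n - m ⊗ (r n)`. -/
def balancingSubgroup (R M N : Type*) [Ring R] [AddCommGroup M] [AddCommGroup N]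
    [Module Rᵐᵒᵖ M] [Module R N] : AddSubgroup (M ⊗[ℤ] N) :=
  AddSubgroup.closure
    {x | ∃ (m : M) (r : R) (n : N), x = (op r • m) ⊗ₜ[ℤ] n - m ⊗ₜ[ℤ] (r • n)}

open scoped TensorProduct in
/-- The tensor product `M ⊗_R N` of a right `R`-module `M` and a left `R`-module `N`. -/
def RTensor (R M N : Type*) [Ring R] [AddCommGroup M] [AddCommGroup N]
    [Module Rᵐᵒᵖ M] [Module R N] : Type _ :=
  (M ⊗[ℤ] N) ⧸ balancingSubgroup R M N

namespace RTensor

open scoped TensorProduct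

section basic

variable {R M N : Type*} [Ring R] [AddCommGroup M] [AddCommGroup N] [Module Rᵐᵒᵖ M] [Module R N]

instance : AddCommGroup (RTensor R M N) :=
  inferInstanceAs (AddCommGroup ((M ⊗[ℤ] N) ⧸ balancingSubgroup R M N))

variable (R) in
/-- The pure tensor `m ⊗ n`. -/
def tmul (m : M) (n : N) : RTensor R M N :=
  QuotientAddGroup.mk' (balancingSubgroup R M N) (m ⊗ₜ[ℤ] n)

theorem add_tmul (m m' : M) (n : N) : tmul R (m + m') n = tmul R m n + tmul R m' n := by
  simp only [tmul, TensorProduct.add_tmul, map_add]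
  rfl

theorem tmul_add (m : M) (n n' : N) : tmul R m (n + n') = tmul R m n + tmul R m n' := by
  simp only [tmul, TensorProduct.tmul_add, map_add]
  rfl

theorem smul_tmul (r : R) (m : M) (n : N) : tmul R (op r • m) n = tmul R m (r • n) := by
  refine (QuotientAddGroup.eq_iff_sub_mem).2 ?_
  exact AddSubgroup.subset_closure ⟨m, r, n, rfl⟩

theorem zero_tmul (n : N) : tmul R (0 : M) n = 0 := by
  have h := add_tmul (R := R) (0 : M) 0 n
  rw [add_zero] at h
  exact left_eq_add.mp h

theorem tmul_zero (m : M) : tmul R m (0 : N) = 0 := by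
  have h := tmul_add (R := R) m (0 : N) 0
  rw [add_zero] at h
  exact left_eq_add.mp h

@[elab_as_elim]
theorem induction_on {p : RTensor R M N → Prop} (x : RTensor R M N) (zero : p 0)
    (tmul : ∀ m n, p (tmul R m n)) (add : ∀ x y, p x → p y → p (x + y)) : p x := by
  obtain ⟨y, rfl⟩ := QuotientAddGroup.mk'_surjective (balancingSubgroup R M N) x
  induction y using TensorProduct.induction_on with
  | zero => exact zero
  | tmul m n => exact tmul m n
  | add y z hy hz => exact add _ _ hy hz

variable {P : Type*} [AddCommGroup P]

/-- The universal property: a biadditive balanced map `M × N → P` factors through `M ⊗_R N`. -/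
def lift (f : M →+ N →+ P) (hf : ∀ m (r : R) n, f (op r • m) n = f m (r • n)) :
    RTensor R M N →+ P :=
  QuotientAddGroup.lift (balancingSubgroup R M N)
    (TensorProduct.liftAddHom f (fun z m n => by simp)) (by
      refine (AddSubgroup.closure_le _).2 ?_
      rintro _ ⟨m, r, n, rfl⟩
      simp [hf, AddMonoidHom.mem_ker])

@[simp] theorem lift_tmul (f : M →+ N →+ P) (hf : ∀ m (r : R) n, f (op r • m) n = f m (r • n))
    (m : M) (n : N) : lift f hf (tmul R m n) = f m n := rfl

theorem hom_ext {f g : RTensor R M N →+ P} (h : ∀ m n, f (tmul R m n) = g (tmul R m n)) :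
    f = g := by
  ext x
  induction x using RTensor.induction_on with
  | zero => simp
  | tmul m n => exact h m n
  | add x y hx hy => simp [hx, hy]

/-- Pure tensors, as a biadditive map. -/
def mkHom (R M N : Type*) [Ring R] [AddCommGroup M] [AddCommGroup N] [Module Rᵐᵒᵖ M]
    [Module R N] : M →+ N →+ RTensor R M N :=
  AddMonoidHom.mk' (fun m => AddMonoidHom.mk' (fun n => tmul R m n) (tmul_add m))
    (fun m m' => by ext n; exact add_tmul m m' n)

@[simp] theorem mkHom_apply (m : M) (n : N) : mkHom R M N m n = tmul R m n := rfl

end basic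

section functoriality

variable {R M N M' N' : Type*} [Ring R] [AddCommGroup M] [AddCommGroup N] [Module Rᵐᵒᵖ M]
  [Module R N] [AddCommGroup M'] [AddCommGroup N'] [Module Rᵐᵒᵖ M'] [Module R N']

/-- `f ⊗ g`. -/
def map (f : M →ₗ[Rᵐᵒᵖ] M') (g : N →ₗ[R] N') : RTensor R M N →+ RTensor R M' N' :=
  lift (((mkHom R M' N').comp f.toAddMonoidHom).compl₂ g.toAddMonoidHom) (fun m r n => by
    simp [smul_tmul])

@[simp] theorem map_tmul (f : M →ₗ[Rᵐᵒᵖ] M') (g : N →ₗ[R] N') (m : M) (n : N) :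
    map f g (tmul R m n) = tmul R (f m) (g n) := rfl

end functoriality

section leftModule

variable {R M N : Type*} [Ring R] [AddCommGroup M] [AddCommGroup N] [Module R M]
  [Module Rᵐᵒᵖ M] [SMulCommClass R Rᵐᵒᵖ M] [Module R N]

/-- Left multiplication by `r` as a right linear map. -/
def lmulHom (r : R) : M →ₗ[Rᵐᵒᵖ] M where
  toFun m := r • m
  map_add' := smul_add r
  map_smul' s m := smul_comm r s m

instance : SMul R (RTensor R M N) := ⟨fun r => map (lmulHom r) LinearMap.id⟩

@[simp] theorem smul_tmul_left (r : R) (m : M) (n : N) :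
    r • tmul R m n = tmul R (r • m) n := rfl

/-- If `M` is a bimodule, `M ⊗_R N` is a left module through `r (m ⊗ n) = (r m) ⊗ n`. -/
instance : Module R (RTensor R M N) where
  smul_zero r := map_zero (map (lmulHom r) LinearMap.id)
  smul_add r := map_add (map (lmulHom r) LinearMap.id)
  one_smul x := by
    induction x using RTensor.induction_on with
    | zero => exact map_zero (map (lmulHom 1) LinearMap.id)
    | tmul m n => simp
    | add x y hx hy =>
      exact (map_add (map (lmulHom 1) LinearMap.id) x y).trans (congrArg₂ _ hx hy)
  mul_smul r s x := by
    have : map (lmulHom (r * s)) LinearMap.id = (map (lmulHom r) LinearMap.id).comp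
        (map (lmulHom s) LinearMap.id) (M := RTensor R M N) :=
      hom_ext fun m n => congrArg (fun m => tmul R m n) (mul_smul r s m)
    exact DFunLike.congr_fun this x
  add_smul r s x := by
    have : map (lmulHom (r + s)) LinearMap.id = map (lmulHom r) LinearMap.id +
        (map (lmulHom s) LinearMap.id : RTensor R M N →+ RTensor R M N) :=
      hom_ext fun m n => (congrArg (fun m => tmul R m n) (add_smul r s m)).trans
        (add_tmul _ _ n)
    exact DFunLike.congr_fun this x
  zero_smul x := by
    have : map (lmulHom 0) LinearMap.id = (0 : RTensor R M N →+ RTensor R M N) :=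
      hom_ext fun m n => (congrArg (fun m => tmul R m n) (zero_smul R m)).trans (zero_tmul n)
    exact DFunLike.congr_fun this x

end leftModule

section rightModule

variable {R M N : Type*} [Ring R] [AddCommGroup M] [AddCommGroup N] [Module Rᵐᵒᵖ M]
  [Module R N] [Module Rᵐᵒᵖ N] [SMulCommClass R Rᵐᵒᵖ N]

/-- Right multiplication as a left linear map. -/
def rmulHom (r : Rᵐᵒᵖ) : N →ₗ[R] N where
  toFun n := r • n
  map_add' := smul_add r
  map_smul' s n := (smul_comm s r n).symm

instance : SMul Rᵐᵒᵖ (RTensor R M N) := ⟨fun r => map LinearMap.id (rmulHom r)⟩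

@[simp] theorem smul_tmul_right (r : Rᵐᵒᵖ) (m : M) (n : N) :
    r • tmul R m n = tmul R m (r • n) := rfl

/-- If `N` is a bimodule, `M ⊗_R N` is a right module through `(m ⊗ n) r = m ⊗ (n r)`. -/
instance : Module Rᵐᵒᵖ (RTensor R M N) where
  smul_zero r := map_zero (map LinearMap.id (rmulHom r))
  smul_add r := map_add (map LinearMap.id (rmulHom r))
  one_smul x := by
    induction x using RTensor.induction_on with
    | zero => exact map_zero (map LinearMap.id (rmulHom 1))
    | tmul m n => simp
    | add x y hx hy =>
      exact (map_add (map LinearMap.id (rmulHom 1)) x y).trans (congrArg₂ _ hx hy)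
  mul_smul r s x := by
    have : map LinearMap.id (rmulHom (r * s)) = (map LinearMap.id (rmulHom r)).comp
        (map LinearMap.id (rmulHom s)) (M := RTensor R M N) :=
      hom_ext fun m n => congrArg (fun n => tmul R m n) (mul_smul r s n)
    exact DFunLike.congr_fun this x
  add_smul r s x := by
    have : map LinearMap.id (rmulHom (r + s)) = map LinearMap.id (rmulHom r) +
        (map LinearMap.id (rmulHom s) : RTensor R M N →+ RTensor R M N) :=
      hom_ext fun m n => (congrArg (fun n => tmul R m n) (add_smul r s n)).trans
        (tmul_add m _ _)
    exact DFunLike.congr_fun this x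
  zero_smul x := by
    have : map LinearMap.id (rmulHom 0) = (0 : RTensor R M N →+ RTensor R M N) :=
      hom_ext fun m n => (congrArg (fun n => tmul R m n) (zero_smul Rᵐᵒᵖ n)).trans (tmul_zero m)
    exact DFunLike.congr_fun this x

end rightModule

section bimodule

variable {R M N : Type*} [Ring R] [AddCommGroup M] [AddCommGroup N] [Module R M]
  [Module Rᵐᵒᵖ M] [SMulCommClass R Rᵐᵒᵖ M] [Module R N] [Module Rᵐᵒᵖ N] [SMulCommClass R Rᵐᵒᵖ N]

instance : SMulCommClass R Rᵐᵒᵖ (RTensor R M N) where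
  smul_comm r s x := by
    induction x using RTensor.induction_on with
    | zero => simp
    | tmul m n => simp
    | add x y hx hy => simp only [smul_add, hx, hy]

end bimodule

section canonicalMaps

variable {R : Type*} [Ring R]

/-- `n ↦ n ⊗ p`, a left linear map. -/
def tmulRight {N P : Type*} [AddCommGroup N] [AddCommGroup P] [Module R N] [Module Rᵐᵒᵖ N]
    [SMulCommClass R Rᵐᵒᵖ N] [Module R P] (p : P) : N →ₗ[R] RTensor R N P where
  toFun n := tmul R n p
  map_add' n n' := add_tmul n n' p
  map_smul' _ _ := rfl

/-- The associativity map `(M ⊗_R N) ⊗_R P → M ⊗_R (N ⊗_R P)`. -/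
def assoc (R M N P : Type*) [Ring R] [AddCommGroup M] [AddCommGroup N] [AddCommGroup P]
    [Module Rᵐᵒᵖ M] [Module R N] [Module Rᵐᵒᵖ N] [SMulCommClass R Rᵐᵒᵖ N] [Module R P] :
    RTensor R (RTensor R M N) P →+ RTensor R M (RTensor R N P) :=
  lift (AddMonoidHom.flip
      (AddMonoidHom.mk' (fun p => map LinearMap.id (tmulRight p)) (fun p p' =>
        hom_ext fun m n => (congrArg (tmul R m) (tmul_add n p p')).trans (tmul_add _ _ _))))
    (fun x r p => by
      induction x using RTensor.induction_on with
      | zero => rw [smul_zero, map_zero, AddMonoidHom.zero_apply, AddMonoidHom.zero_apply]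
      | tmul m n => exact congrArg (tmul R m) (smul_tmul r n p)
      | add x y hx hy => rw [smul_add, map_add, map_add, AddMonoidHom.add_apply,
          AddMonoidHom.add_apply, hx, hy])

@[simp] theorem assoc_tmul {M N P : Type*} [AddCommGroup M] [AddCommGroup N] [AddCommGroup P]
    [Module Rᵐᵒᵖ M] [Module R N] [Module Rᵐᵒᵖ N] [SMulCommClass R Rᵐᵒᵖ N] [Module R P]
    (m : M) (n : N) (p : P) :
    assoc R M N P (tmul R (tmul R m n) p) = tmul R m (tmul R n p) := rfl

/-- The canonical map `R ⊗_R N → N`. -/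
def lid (R N : Type*) [Ring R] [AddCommGroup N] [Module R N] : RTensor R R N →+ N :=
  lift (AddMonoidHom.mk' (fun r => AddMonoidHom.mk' (fun n => r • n) (smul_add r))
      (fun r s => by ext n; exact add_smul r s n))
    (fun r s n => by simp [mul_smul])

@[simp] theorem lid_tmul {N : Type*} [AddCommGroup N] [Module R N] (r : R) (n : N) :
    lid R N (tmul R r n) = r • n := rfl

/-- The canonical map `M ⊗_R R → M`. -/
def rid (R M : Type*) [Ring R] [AddCommGroup M] [Module Rᵐᵒᵖ M] : RTensor R M R →+ M :=
  lift (AddMonoidHom.mk' (fun m => AddMonoidHom.mk' (fun r : R => op r • m)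
        (fun r s => by rw [MulOpposite.op_add, add_smul]))
      (fun m m' => by ext r; exact smul_add (op r) m m'))
    (fun m s r => by simp [mul_smul])

@[simp] theorem rid_tmul {M : Type*} [AddCommGroup M] [Module Rᵐᵒᵖ M] (m : M) (r : R) :
    rid R M (tmul R m r) = op r • m := rfl

end canonicalMaps

end RTensor

/-! ## Corings and associative rings over `R` -/

/-- A coassociative and counital `R`-coring structure on the `R`-bimodule `C`. -/
class RCoring (R : Type*) (C : Type*) [Ring R] [AddCommGroup C] [Module R C] [Module Rᵐᵒᵖ C]
    [SMulCommClass R Rᵐᵒᵖ C] where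
  comul : BimodMap R C (RTensor R C C)
  counit : BimodMap R C R
  coassoc : ∀ c : C, RTensor.assoc R C C C (RTensor.map comul.right LinearMap.id (comul c)) =
    RTensor.map LinearMap.id comul.left (comul c)
  counit_left : ∀ c : C, RTensor.lid R C (RTensor.map counit.right LinearMap.id (comul c)) = c
  counit_right : ∀ c : C, RTensor.rid R C (RTensor.map LinearMap.id counit.left (comul c)) = c

/-- An associative `R`-ring, not necessarily with unity: an `R`-bimodule `A` with an associative
biadditive multiplication that is `R`-balanced and `R`-bilinear. -/
class IsRRing (R : Type*) (A : Type*) [Ring R] [NonUnitalRing A] [Module R A] [Module Rᵐᵒᵖ A] :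
    Prop extends SMulCommClass R Rᵐᵒᵖ A where
  smul_mul' : ∀ (r : R) (a b : A), (r • a) * b = r • (a * b)
  mul_op_smul' : ∀ (r : R) (a b : A), a * (op r • b) = op r • (a * b)
  op_smul_mul' : ∀ (r : R) (a b : A), (op r • a) * b = a * (r • b)

/-! ## The two duals of a bimodule -/

/-- `*U`, the left `R`-linear maps `U → R`. -/
def LeftDual (R U : Type*) [Ring R] [AddCommGroup U] [Module R U] : Type _ := U →ₗ[R] R

/-- `U*`, the right `R`-linear maps `U → R`. -/
def RightDual (R U : Type*) [Ring R] [AddCommGroup U] [Module Rᵐᵒᵖ U] : Type _ := U →ₗ[Rᵐᵒᵖ] R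

section duals

variable {R U : Type*} [Ring R] [AddCommGroup U]

namespace LeftDual

variable [Module R U]

instance : AddCommGroup (LeftDual R U) := inferInstanceAs (AddCommGroup (U →ₗ[R] R))

instance : FunLike (LeftDual R U) U R := inferInstanceAs (FunLike (U →ₗ[R] R) U R)

instance : LinearMapClass (LeftDual R U) R U R :=
  inferInstanceAs (LinearMapClass (U →ₗ[R] R) R U R)

@[ext] theorem ext {f g : LeftDual R U} (h : ∀ u, f u = g u) : f = g := DFunLike.ext _ _ h

@[simp] theorem add_apply (f g : LeftDual R U) (u : U) : (f + g) u = f u + g u := rfl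

@[simp] theorem zero_apply (u : U) : (0 : LeftDual R U) u = 0 := rfl

/-- `(f r)(u) = f(u) r`. -/
instance : Module Rᵐᵒᵖ (LeftDual R U) := inferInstanceAs (Module Rᵐᵒᵖ (U →ₗ[R] R))

@[simp] theorem op_smul_apply (r : R) (f : LeftDual R U) (u : U) : (op r • f) u = f u * r := rfl

variable [Module Rᵐᵒᵖ U] [SMulCommClass R Rᵐᵒᵖ U]

instance : SMul R (LeftDual R U) := ⟨fun r f => LinearMap.comp f (RTensor.rmulHom (op r))⟩

@[simp] theorem smul_apply (r : R) (f : LeftDual R U) (u : U) : (r • f) u = f (op r • u) := rfl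

/-- `(r f)(u) = f(u r)`. -/
instance : Module R (LeftDual R U) where
  smul_zero r := rfl
  smul_add r f g := rfl
  one_smul f := by ext u; simp
  mul_smul r s f := by ext u; simp [mul_smul]
  add_smul r s f := by ext u; simp [add_smul]
  zero_smul f := by ext u; simp

instance : SMulCommClass R Rᵐᵒᵖ (LeftDual R U) where
  smul_comm _ _ _ := rfl

end LeftDual

namespace RightDual

variable [Module Rᵐᵒᵖ U]

instance : AddCommGroup (RightDual R U) := inferInstanceAs (AddCommGroup (U →ₗ[Rᵐᵒᵖ] R))

instance : FunLike (RightDual R U) U R := inferInstanceAs (FunLike (U →ₗ[Rᵐᵒᵖ] R) U R)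

instance : LinearMapClass (RightDual R U) Rᵐᵒᵖ U R :=
  inferInstanceAs (LinearMapClass (U →ₗ[Rᵐᵒᵖ] R) Rᵐᵒᵖ U R)

@[ext] theorem ext {f g : RightDual R U} (h : ∀ u, f u = g u) : f = g := DFunLike.ext _ _ h

@[simp] theorem add_apply (f g : RightDual R U) (u : U) : (f + g) u = f u + g u := rfl

@[simp] theorem zero_apply (u : U) : (0 : RightDual R U) u = 0 := rfl

/-- `(r f)(u) = r f(u)`. -/
instance : Module R (RightDual R U) := inferInstanceAs (Module R (U →ₗ[Rᵐᵒᵖ] R))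

@[simp] theorem smul_apply (r : R) (f : RightDual R U) (u : U) : (r • f) u = r * f u := rfl

variable [Module R U] [SMulCommClass R Rᵐᵒᵖ U]

instance : SMul Rᵐᵒᵖ (RightDual R U) := ⟨fun r f => LinearMap.comp f (RTensor.lmulHom r.unop)⟩

@[simp] theorem op_smul_apply (r : R) (f : RightDual R U) (u : U) :
    (op r • f) u = f (r • u) := rfl

/-- `(f r)(u) = f(r u)`. -/
instance : Module Rᵐᵒᵖ (RightDual R U) where
  smul_zero r := rfl
  smul_add r f g := rfl
  one_smul f := by ext u; exact congrArg f (one_smul R u)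
  mul_smul r s f := by ext u; exact congrArg f (mul_smul s.unop r.unop u)
  add_smul r s f := by
    ext u; exact (congrArg f (add_smul r.unop s.unop u)).trans (map_add f _ _)
  zero_smul f := by ext u; exact (congrArg f (zero_smul R u)).trans (map_zero f)

instance : SMulCommClass R Rᵐᵒᵖ (RightDual R U) where
  smul_comm _ _ _ := rfl

end RightDual

/-- The finite topology on `*U`, induced by the product topology on `R^U` (`R` discrete). -/
@[reducible] def LeftDual.finiteTopology (R U : Type*) [Ring R] [AddCommGroup U] [Module R U] :
    TopologicalSpace (LeftDual R U) :=
  TopologicalSpace.induced (fun f => (f : U → R)) (@Pi.topologicalSpace U (fun _ => R) fun _ => ⊥)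

/-- The finite topology on `U*`, induced by the product topology on `R^U` (`R` discrete). -/
@[reducible] def RightDual.finiteTopology (R U : Type*) [Ring R] [AddCommGroup U] [Module Rᵐᵒᵖ U] :
    TopologicalSpace (RightDual R U) :=
  TopologicalSpace.induced (fun f => (f : U → R)) (@Pi.topologicalSpace U (fun _ => R) fun _ => ⊥)

end duals

/-! ## Evaluation of tensors at functionals -/

section evaluation

variable {R : Type*} [Ring R]

/-- `m ⊗ w ↦ m f(w)`, for a left linear functional `f`. -/
def LeftDual.eval {M W : Type*} [AddCommGroup M] [AddCommGroup W] [Module Rᵐᵒᵖ M] [Module R W]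
    (f : LeftDual R W) : RTensor R M W →+ M :=
  RTensor.lift (AddMonoidHom.mk' (fun m => AddMonoidHom.mk' (fun w => op (f w) • m)
        (fun w w' => by rw [map_add, MulOpposite.op_add, add_smul]))
      (fun m m' => by ext w; exact smul_add _ m m'))
    (fun m r w => by simp [mul_smul])

@[simp] theorem LeftDual.eval_tmul {M W : Type*} [AddCommGroup M] [AddCommGroup W]
    [Module Rᵐᵒᵖ M] [Module R W] (f : LeftDual R W) (m : M) (w : W) :
    f.eval (RTensor.tmul R m w) = op (f w) • m := rfl

/-- `w ⊗ m ↦ f(w) m`, for a right linear functional `f`. -/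
def RightDual.eval {M W : Type*} [AddCommGroup M] [AddCommGroup W] [Module R M] [Module Rᵐᵒᵖ W]
    (f : RightDual R W) : RTensor R W M →+ M :=
  RTensor.lift (AddMonoidHom.mk' (fun w => AddMonoidHom.mk' (fun m => f w • m)
        (fun m m' => smul_add _ m m'))
      (fun w w' => by
        ext m
        simp [map_add, add_smul]))
    (fun w r m => by simp [mul_smul])

@[simp] theorem RightDual.eval_tmul {M W : Type*} [AddCommGroup M] [AddCommGroup W]
    [Module R M] [Module Rᵐᵒᵖ W] (f : RightDual R W) (w : W) (m : M) :
    f.eval (RTensor.tmul R w m) = f w • m := rfl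

section linearity

variable {M W : Type*} [AddCommGroup M] [AddCommGroup W] [Module R M] [Module Rᵐᵒᵖ M]
  [SMulCommClass R Rᵐᵒᵖ M]

theorem LeftDual.eval_smul [Module R W] (f : LeftDual R W) (r : R) (x : RTensor R M W) :
    f.eval (r • x) = r • f.eval x := by
  induction x using RTensor.induction_on with
  | zero => simp
  | tmul m w => simp [smul_comm]
  | add x y hx hy => simp only [smul_add, map_add, hx, hy]

theorem RightDual.eval_op_smul [Module Rᵐᵒᵖ W] (f : RightDual R W) (r : R) (x : RTensor R W M) :
    f.eval (op r • x) = op r • f.eval x := by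
  induction x using RTensor.induction_on with
  | zero => simp
  | tmul w m => simp [smul_comm]
  | add x y hx hy => simp only [smul_add, map_add, hx, hy]

end linearity

theorem LeftDual.eval_op_smul {M W : Type*} [AddCommGroup M] [AddCommGroup W]
    [Module Rᵐᵒᵖ M] [Module R W] [Module Rᵐᵒᵖ W] [SMulCommClass R Rᵐᵒᵖ W]
    (f : LeftDual R W) (r : R) (x : RTensor R M W) :
    f.eval (op r • x) = (r • f).eval x := by
  induction x using RTensor.induction_on with
  | zero => simp
  | tmul m w => simp
  | add x y hx hy => simp only [smul_add, map_add, hx, hy]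

theorem RightDual.eval_smul {M W : Type*} [AddCommGroup M] [AddCommGroup W]
    [Module R M] [Module R W] [Module Rᵐᵒᵖ W] [SMulCommClass R Rᵐᵒᵖ W]
    (f : RightDual R W) (r : R) (x : RTensor R W M) :
    f.eval (r • x) = (op r • f).eval x := by
  induction x using RTensor.induction_on with
  | zero => simp
  | tmul m w => simp
  | add x y hx hy => simp only [smul_add, map_add, hx, hy]

theorem LeftDual.op_smul_eval {M W : Type*} [AddCommGroup M] [AddCommGroup W]
    [Module Rᵐᵒᵖ M] [Module R W] (f : LeftDual R W) (r : R) (x : RTensor R M W) :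
    op r • f.eval x = (op r • f).eval x := by
  induction x using RTensor.induction_on with
  | zero => simp
  | tmul m w => simp [mul_smul]
  | add x y hx hy => simp only [smul_add, map_add, hx, hy]

theorem RightDual.smul_eval {M W : Type*} [AddCommGroup M] [AddCommGroup W]
    [Module R M] [Module Rᵐᵒᵖ W] (f : RightDual R W) (r : R) (x : RTensor R W M) :
    r • f.eval x = (r • f).eval x := by
  induction x using RTensor.induction_on with
  | zero => simp
  | tmul m w => simp [mul_smul]
  | add x y hx hy => simp only [smul_add, map_add, hx, hy]

theorem LeftDual.add_eval {M W : Type*} [AddCommGroup M] [AddCommGroup W]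
    [Module Rᵐᵒᵖ M] [Module R W] (f g : LeftDual R W) (x : RTensor R M W) :
    (f + g).eval x = f.eval x + g.eval x := by
  induction x using RTensor.induction_on with
  | zero => simp
  | tmul m w => simp [add_smul]
  | add x y hx hy => simp only [map_add, hx, hy]; abel

theorem RightDual.add_eval {M W : Type*} [AddCommGroup M] [AddCommGroup W]
    [Module R M] [Module Rᵐᵒᵖ W] (f g : RightDual R W) (x : RTensor R W M) :
    (f + g).eval x = f.eval x + g.eval x := by
  induction x using RTensor.induction_on with
  | zero => simp
  | tmul m w => simp [add_smul]
  | add x y hx hy => simp only [map_add, hx, hy]; abel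

theorem LeftDual.eval_map {M N W : Type*} [AddCommGroup M] [AddCommGroup N] [AddCommGroup W]
    [Module Rᵐᵒᵖ M] [Module Rᵐᵒᵖ N] [Module R W] (f : LeftDual R W) (g : M →ₗ[Rᵐᵒᵖ] N)
    (x : RTensor R M W) : f.eval (RTensor.map g LinearMap.id x) = g (f.eval x) := by
  induction x using RTensor.induction_on with
  | zero => simp
  | tmul m w => simp
  | add x y hx hy => simp only [map_add, hx, hy]

theorem RightDual.eval_map {M N W : Type*} [AddCommGroup M] [AddCommGroup N] [AddCommGroup W]
    [Module R M] [Module R N] [Module Rᵐᵒᵖ W] (f : RightDual R W) (g : M →ₗ[R] N)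
    (x : RTensor R W M) : f.eval (RTensor.map LinearMap.id g x) = g (f.eval x) := by
  induction x using RTensor.induction_on with
  | zero => simp
  | tmul w m => simp
  | add x y hx hy => simp only [map_add, hx, hy]

end evaluation

/-! ## The dual rings of a coring -/

section dualRings

variable {R C : Type*} [Ring R] [AddCommGroup C] [Module R C] [Module Rᵐᵒᵖ C]
  [SMulCommClass R Rᵐᵒᵖ C] [RCoring R C]

namespace LeftDual

/-- `c ↦ ∑ c₁ f(c₂)`, a left linear map. -/
def act (f : LeftDual R C) : C →ₗ[R] C where
  toFun c := f.eval (RCoring.comul (R := R) c)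
  map_add' c d := by simp
  map_smul' r c := by simp [eval_smul]

theorem act_apply (f : LeftDual R C) (c : C) : f.act c = f.eval (RCoring.comul (R := R) c) := rfl

/-- The product `(f ⋆ g)(c) = ∑ g(c₁ f(c₂))` on `*C`. -/
instance : Mul (LeftDual R C) := ⟨fun f g => LinearMap.comp g f.act⟩

theorem mul_apply (f g : LeftDual R C) (c : C) :
    (f * g) c = g (f.eval (RCoring.comul (R := R) c)) := rfl

/-- A right coaction turns the product of `*C` into composition of actions. -/
theorem eval_eval {M : Type*} [AddCommGroup M] [Module Rᵐᵒᵖ M] (ρ : M →ₗ[Rᵐᵒᵖ] RTensor R M C)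
    (hρ : ∀ m, RTensor.assoc R M C C (RTensor.map ρ LinearMap.id (ρ m)) =
      RTensor.map LinearMap.id (RCoring.comul (R := R) (C := C)).left (ρ m))
    (f g : LeftDual R C) (m : M) :
    g.eval (ρ (f.eval (ρ m))) = (f * g).eval (ρ m) := by
  let T : RTensor R M (RTensor R C C) →+ M :=
    RTensor.lift (AddMonoidHom.mk' (fun m => AddMonoidHom.mk' (fun x => op (g (f.eval x)) • m)
        (fun w w' => by rw [map_add, map_add, MulOpposite.op_add, add_smul]))
      (fun m m' => by ext w; exact smul_add _ m m'))
      (fun m r w => by simp [eval_smul, mul_smul])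
  have h1 : ∀ x : RTensor R M C, T (RTensor.map LinearMap.id
      (RCoring.comul (R := R) (C := C)).left x) = (f * g).eval x := by
    intro x
    induction x using RTensor.induction_on with
    | zero => simp
    | tmul m c => rfl
    | add x y hx hy => simp only [map_add, hx, hy]
  have h2 : ∀ (y : RTensor R M C) (c : C),
      T (RTensor.assoc R M C C (RTensor.tmul R y c)) = g.eval (op (f c) • y) := by
    intro y c
    induction y using RTensor.induction_on with
    | zero => simp [RTensor.zero_tmul]
    | tmul m d => rfl
    | add x y hx hy => simp only [RTensor.add_tmul, map_add, smul_add, hx, hy]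
  have h3 : ∀ x : RTensor R M C, T (RTensor.assoc R M C C (RTensor.map ρ LinearMap.id x)) =
      g.eval (ρ (f.eval x)) := by
    intro x
    induction x using RTensor.induction_on with
    | zero => simp
    | tmul m c => simpa using h2 (ρ m) c
    | add x y hx hy => simp only [map_add, hx, hy]
  rw [← h3, ← h1, hρ]

/-- `*C` as an associative ring. -/
instance : NonUnitalRing (LeftDual R C) :=
  { (inferInstance : AddCommGroup (LeftDual R C)), (inferInstance : Mul (LeftDual R C)) with
    left_distrib := fun f g h => rfl
    right_distrib := fun f g h => by
      ext c
      simp [mul_apply, add_eval]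
    zero_mul := fun f => by
      ext c
      have h : (0 : LeftDual R C).eval (RCoring.comul (R := R) c) = 0 := by
        have := add_eval (0 : LeftDual R C) 0 (RCoring.comul (R := R) c)
        rw [add_zero] at this
        exact left_eq_add.mp this
      simp [mul_apply, h]
    mul_zero := fun f => rfl
    mul_assoc := fun f g h => by
      ext c
      rw [mul_apply, mul_apply, mul_apply]
      exact congrArg h (eval_eval RCoring.comul.right RCoring.coassoc f g c).symm }

instance : IsRRing R (LeftDual R C) where
  smul_mul' r f g := by
    ext c
    simp [mul_apply, eval_op_smul]
  mul_op_smul' r f g := rfl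
  op_smul_mul' r f g := by
    ext c
    simp [mul_apply, op_smul_eval]

end LeftDual

namespace RightDual

/-- `c ↦ ∑ f(c₁) c₂`, a right linear map. -/
def act (f : RightDual R C) : C →ₗ[Rᵐᵒᵖ] C where
  toFun c := f.eval (RCoring.comul (R := R) c)
  map_add' c d := by simp
  map_smul' r c := by
    have := eval_op_smul f r.unop (RCoring.comul (R := R) c)
    simpa using this

theorem act_apply (f : RightDual R C) (c : C) : f.act c = f.eval (RCoring.comul (R := R) c) := rfl

/-- The product `(f ⋆ g)(c) = ∑ f(g(c₁) c₂)` on `C*`. -/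
instance : Mul (RightDual R C) := ⟨fun f g => LinearMap.comp f g.act⟩

theorem mul_apply (f g : RightDual R C) (c : C) :
    (f * g) c = f (g.eval (RCoring.comul (R := R) c)) := rfl

/-- A left coaction turns the product of `C*` into composition of actions. -/
theorem eval_eval {M : Type*} [AddCommGroup M] [Module R M] (ρ : M →ₗ[R] RTensor R C M)
    (hρ : ∀ m, RTensor.assoc R C C M
        (RTensor.map (RCoring.comul (R := R) (C := C)).right LinearMap.id (ρ m)) =
      RTensor.map LinearMap.id ρ (ρ m))
    (f g : RightDual R C) (m : M) :
    f.eval (ρ (g.eval (ρ m))) = (f * g).eval (ρ m) := by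
  let S : RTensor R C (RTensor R C M) →+ M :=
    RTensor.lift (AddMonoidHom.mk' (fun c => f.eval.comp
        (AddMonoidHom.mk' (fun x : RTensor R C M => g c • x) (smul_add (g c))))
      (fun c c' => by ext x; simp [add_smul]))
      (fun c r x => by simp [mul_smul])
  have h1 : ∀ x : RTensor R C M, S (RTensor.map LinearMap.id ρ x) = f.eval (ρ (g.eval x)) := by
    intro x
    induction x using RTensor.induction_on with
    | zero => simp
    | tmul c m => simp [S]
    | add x y hx hy => simp only [map_add, hx, hy]
  have h2 : ∀ (y : RTensor R C C) (m : M),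
      S (RTensor.assoc R C C M (RTensor.tmul R y m)) = f (g.eval y) • m := by
    intro y m
    induction y using RTensor.induction_on with
    | zero => simp [RTensor.zero_tmul]
    | tmul c d => rfl
    | add x y hx hy => simp only [RTensor.add_tmul, map_add, add_smul, hx, hy]
  have h3 : ∀ x : RTensor R C M, S (RTensor.assoc R C C M
      (RTensor.map (RCoring.comul (R := R) (C := C)).right LinearMap.id x)) = (f * g).eval x := by
    intro x
    induction x using RTensor.induction_on with
    | zero => simp
    | tmul c m => exact h2 _ m
    | add x y hx hy => simp only [map_add, hx, hy]
  rw [← h1, ← h3, hρ]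

/-- `C*` as an associative ring. -/
instance : NonUnitalRing (RightDual R C) :=
  { (inferInstance : AddCommGroup (RightDual R C)), (inferInstance : Mul (RightDual R C)) with
    right_distrib := fun f g h => rfl
    left_distrib := fun f g h => by
      ext c
      simp [mul_apply, add_eval]
    mul_zero := fun f => by
      ext c
      have h : (0 : RightDual R C).eval (RCoring.comul (R := R) c) = 0 := by
        have := add_eval (0 : RightDual R C) 0 (RCoring.comul (R := R) c)
        rw [add_zero] at this
        exact left_eq_add.mp this
      simp [mul_apply, h]
    zero_mul := fun f => rfl
    mul_assoc := fun f g h => by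
      ext c
      rw [mul_apply, mul_apply, mul_apply]
      have := eval_eval (RCoring.comul (R := R) (C := C)).left RCoring.coassoc g h c
      simp only [BimodMap.left_apply] at this
      rw [this] }

instance : IsRRing R (RightDual R C) where
  smul_mul' r f g := rfl
  mul_op_smul' r f g := by
    ext c
    simp [mul_apply, eval_smul]
  op_smul_mul' r f g := by
    ext c
    simp [mul_apply, smul_eval]

end RightDual

end dualRings

/-! ## Measuring pairings -/

/-- A measuring left `R`-pairing `(A, C)`: a morphism of `R`-rings `κ : A → *C`
(`A` not necessarily with unity). -/
structure MeasuringLeftPairing (R A C : Type*) [Ring R] [NonUnitalRing A] [Module R A]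
    [Module Rᵐᵒᵖ A] [IsRRing R A] [AddCommGroup C] [Module R C] [Module Rᵐᵒᵖ C]
    [SMulCommClass R Rᵐᵒᵖ C] [RCoring R C] where
  κ : BimodMap R A (LeftDual R C)
  map_mul : ∀ a b : A, κ (a * b) = κ a * κ b

/-- A measuring right `R`-pairing `(B, D)`: a morphism of `R`-rings `κ : B → D*`
(`B` not necessarily with unity). -/
structure MeasuringRightPairing (R B D : Type*) [Ring R] [NonUnitalRing B] [Module R B]
    [Module Rᵐᵒᵖ B] [IsRRing R B] [AddCommGroup D] [Module R D] [Module Rᵐᵒᵖ D]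
    [SMulCommClass R Rᵐᵒᵖ D] [RCoring R D] where
  κ : BimodMap R B (RightDual R D)
  map_mul : ∀ a b : B, κ (a * b) = κ a * κ b

/-- `κ(A)` is dense in `*C` for the finite topology. -/
def MeasuringLeftPairing.IsDense {R A C : Type*} [Ring R] [NonUnitalRing A] [Module R A]
    [Module Rᵐᵒᵖ A] [IsRRing R A] [AddCommGroup C] [Module R C] [Module Rᵐᵒᵖ C]
    [SMulCommClass R Rᵐᵒᵖ C] [RCoring R C] (P : MeasuringLeftPairing R A C) : Prop :=
  @Dense _ (LeftDual.finiteTopology R C) (Set.range P.κ)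

/-- `κ(B)` is dense in `D*` for the finite topology. -/
def MeasuringRightPairing.IsDense {R B D : Type*} [Ring R] [NonUnitalRing B] [Module R B]
    [Module Rᵐᵒᵖ B] [IsRRing R B] [AddCommGroup D] [Module R D] [Module Rᵐᵒᵖ D]
    [SMulCommClass R Rᵐᵒᵖ D] [RCoring R D] (Q : MeasuringRightPairing R B D) : Prop :=
  @Dense _ (RightDual.finiteTopology R D) (Set.range Q.κ)

/-- The measuring left pairing `(*C, C)`. -/
def LeftDual.pairing (R C : Type*) [Ring R] [AddCommGroup C] [Module R C] [Module Rᵐᵒᵖ C]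
    [SMulCommClass R Rᵐᵒᵖ C] [RCoring R C] : MeasuringLeftPairing R (LeftDual R C) C where
  κ := BimodMap.id R (LeftDual R C)
  map_mul _ _ := rfl

/-- The measuring right pairing `(D*, D)`. -/
def RightDual.pairing (R D : Type*) [Ring R] [AddCommGroup D] [Module R D] [Module Rᵐᵒᵖ D]
    [SMulCommClass R Rᵐᵒᵖ D] [RCoring R D] : MeasuringRightPairing R (RightDual R D) D where
  κ := BimodMap.id R (RightDual R D)
  map_mul _ _ := rfl

/-- A left `S`-module `W` is locally projective: for every surjection `π : L → N`, every
`g : W → N` and every finitely generated `F ⊆ W` there is `g' : W → L` such that `π ∘ g'` and `g`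
agree on `F`. (A right `R`-module is a left module over `Rᵐᵒᵖ`.) -/
def IsLocallyProjective (S : Type u) (W : Type w) [Ring S] [AddCommGroup W] [Module S W] : Prop :=
  ∀ (L N : Type (max u w)) [AddCommGroup L] [AddCommGroup N] [Module S L] [Module S N]
    (π : L →ₗ[S] N) (_ : Function.Surjective π) (g : W →ₗ[S] N) (F : Submodule S W) (_ : F.FG),
    ∃ g' : W →ₗ[S] L, ∀ x ∈ F, π (g' x) = g x

/-! ## The category of bicomodules -/

open CategoryTheory

/-- A bundled `R`-bimodule. -/
structure RBimodule (R : Type*) [Ring R] where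
  carrier : Type v
  [addCommGroup : AddCommGroup carrier]
  [moduleLeft : Module R carrier]
  [moduleRight : Module Rᵐᵒᵖ carrier]
  [smulComm : SMulCommClass R Rᵐᵒᵖ carrier]

attribute [instance] RBimodule.addCommGroup RBimodule.moduleLeft RBimodule.moduleRight
  RBimodule.smulComm

section bicomodules

variable (R D C : Type*) [Ring R]
  [AddCommGroup D] [Module R D] [Module Rᵐᵒᵖ D] [SMulCommClass R Rᵐᵒᵖ D] [RCoring R D]
  [AddCommGroup C] [Module R C] [Module Rᵐᵒᵖ C] [SMulCommClass R Rᵐᵒᵖ C] [RCoring R C]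

/-- A `(D, C)`-bicomodule: an `R`-bimodule with a right `C`-coaction and a left `D`-coaction, each
of them coassociative and colinear for the other (in particular, both are `R`-bilinear). -/
structure Bicomodule extends RBimodule.{v} R where
  rcoact : BimodMap R carrier (RTensor R carrier C)
  rcoassoc : ∀ m, RTensor.assoc R carrier C C (RTensor.map rcoact.right LinearMap.id (rcoact m)) =
    RTensor.map LinearMap.id (RCoring.comul (R := R) (C := C)).left (rcoact m)
  lcoact : BimodMap R carrier (RTensor R D carrier)
  lcoassoc : ∀ m, RTensor.assoc R D D carrier
      (RTensor.map (RCoring.comul (R := R) (C := D)).right LinearMap.id (lcoact m)) =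
    RTensor.map LinearMap.id lcoact.left (lcoact m)
  compat : ∀ m, RTensor.assoc R D carrier C (RTensor.map lcoact.right LinearMap.id (rcoact m)) =
    RTensor.map LinearMap.id rcoact.left (lcoact m)

variable {R D C}

/-- Bicolinear maps. -/
@[ext] structure Bicomodule.Hom (M N : Bicomodule.{v} R D C) where
  toMap : BimodMap R M.carrier N.carrier
  rcolinear : ∀ m, N.rcoact (toMap m) = RTensor.map toMap.right LinearMap.id (M.rcoact m)
  lcolinear : ∀ m, N.lcoact (toMap m) = RTensor.map LinearMap.id toMap.left (M.lcoact m)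

theorem RTensor.map_right_id {M N : Type*} [AddCommGroup M] [AddCommGroup N] [Module Rᵐᵒᵖ M]
    [Module R N] (x : RTensor R M N) :
    RTensor.map (LinearMap.id : M →ₗ[Rᵐᵒᵖ] M) (LinearMap.id : N →ₗ[R] N) x = x := by
  induction x using RTensor.induction_on with
  | zero => simp
  | tmul m n => rfl
  | add x y hx hy => simp only [map_add, hx, hy]

instance : Category (Bicomodule.{v} R D C) where
  Hom := Bicomodule.Hom
  id M :=
    { toMap := BimodMap.id R M.carrier
      rcolinear := fun m => (RTensor.map_right_id _).symm
      lcolinear := fun m => (RTensor.map_right_id _).symm }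
  comp {L M N} f g :=
    { toMap := g.toMap.comp f.toMap
      rcolinear := fun m => by
        rw [BimodMap.comp_apply, g.rcolinear, f.rcolinear]
        generalize L.rcoact m = x
        induction x using RTensor.induction_on with
        | zero => simp
        | tmul m n => rfl
        | add x y hx hy => simp only [map_add, hx, hy]
      lcolinear := fun m => by
        rw [BimodMap.comp_apply, g.lcolinear, f.lcolinear]
        generalize L.lcoact m = x
        induction x using RTensor.induction_on with
        | zero => simp
        | tmul m n => rfl
        | add x y hx hy => simp only [map_add, hx, hy] }

variable (R D C) in
/-- A bicomodule is counital if both coactions are injective. -/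
def Bicomodule.IsCounital : ObjectProperty (Bicomodule.{v} R D C) := fun M =>
  Function.Injective M.rcoact ∧ Function.Injective M.lcoact

end bicomodules

/-! ## The category of `(B, A)`-bimodules over `R`-rings -/

section bimodules

variable (R B A : Type*) [Ring R]
  [NonUnitalRing B] [Module R B] [Module Rᵐᵒᵖ B] [IsRRing R B]
  [NonUnitalRing A] [Module R A] [Module Rᵐᵒᵖ A] [IsRRing R A]

/-- A `(B, A)`-bimodule over (not necessarily unital) `R`-rings: an `R`-bimodule `M` with
associative `R`-balanced actions `B × M → M`, written `lact b m`, and `M × A → M`, written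
`ract m a`, each of which is `R`-bilinear, and which commute with each other. -/
structure RingBimodule extends RBimodule.{v} R where
  ract : carrier →+ A →+ carrier
  ract_mul : ∀ m a a', ract m (a * a') = ract (ract m a) a'
  ract_balanced : ∀ m (r : R) a, ract (op r • m) a = ract m (r • a)
  ract_op_smul : ∀ m (r : R) a, ract m (op r • a) = op r • ract m a
  ract_smul : ∀ m (r : R) a, ract (r • m) a = r • ract m a
  lact : B →+ carrier →+ carrier
  lact_mul : ∀ b b' m, lact (b * b') m = lact b (lact b' m)
  lact_balanced : ∀ b (r : R) m, lact (op r • b) m = lact b (r • m)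
  lact_smul : ∀ b (r : R) m, lact (r • b) m = r • lact b m
  lact_op_smul : ∀ b (r : R) m, lact b (op r • m) = op r • lact b m
  lact_ract : ∀ b m a, ract (lact b m) a = lact b (ract m a)

variable {R B A}

/-- `(B, A)`-bilinear maps. -/
@[ext] structure RingBimodule.Hom (M N : RingBimodule.{v} R B A) where
  toMap : BimodMap R M.carrier N.carrier
  map_ract : ∀ m a, toMap (M.ract m a) = N.ract (toMap m) a
  map_lact : ∀ b m, toMap (M.lact b m) = N.lact b (toMap m)

instance : Category (RingBimodule.{v} R B A) where
  Hom := RingBimodule.Hom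
  id M :=
    { toMap := BimodMap.id R M.carrier
      map_ract := fun _ _ => rfl
      map_lact := fun _ _ => rfl }
  comp f g :=
    { toMap := g.toMap.comp f.toMap
      map_ract := fun m a => by simp [f.map_ract, g.map_ract]
      map_lact := fun b m => by simp [f.map_lact, g.map_lact] }

variable (R B A) in
/-- `M` is `(B, A)`-faithful: `M → Hom(A, M)` and `M → Hom(B, M)` are injective. -/
def RingBimodule.IsFaithful : ObjectProperty (RingBimodule.{v} R B A) := fun M =>
  Function.Injective (fun (m : M.carrier) (a : A) => M.ract m a) ∧
    Function.Injective (fun (m : M.carrier) (b : B) => M.lact b m)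

variable (R B A) in
/-- `M` is unital: `M A = M` and `B M = M`. -/
def RingBimodule.IsUnital : ObjectProperty (RingBimodule.{v} R B A) := fun M =>
  AddSubgroup.closure {x : M.carrier | ∃ m a, x = M.ract m a} = ⊤ ∧
    AddSubgroup.closure {x : M.carrier | ∃ b m, x = M.lact b m} = ⊤

end bimodules

/-! ## Birational bimodules -/

section birational

variable {R A B C D : Type*} [Ring R]
  [NonUnitalRing A] [Module R A] [Module Rᵐᵒᵖ A] [IsRRing R A]
  [NonUnitalRing B] [Module R B] [Module Rᵐᵒᵖ B] [IsRRing R B]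
  [AddCommGroup C] [Module R C] [Module Rᵐᵒᵖ C] [SMulCommClass R Rᵐᵒᵖ C] [RCoring R C]
  [AddCommGroup D] [Module R D] [Module Rᵐᵒᵖ D] [SMulCommClass R Rᵐᵒᵖ D] [RCoring R D]
  (P : MeasuringLeftPairing R A C) (Q : MeasuringRightPairing R B D)

/-- The `C`-rational part of `M_A`: the `m` for which there is `∑ mᵢ ⊗ cᵢ` with
`m a = ∑ mᵢ ⟨a, cᵢ⟩` for all `a`. -/
def RingBimodule.rightRat (M : RingBimodule.{v} R B A) : Set M.carrier :=
  {m | ∃ t : RTensor R M.carrier C, ∀ a, M.ract m a = (P.κ a).eval t}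

/-- The `D`-rational part of `_B M`: the `m` for which there is `∑ dᵢ ⊗ mᵢ` with
`b m = ∑ ⟨b, dᵢ⟩ mᵢ` for all `b`. -/
def RingBimodule.leftRat (M : RingBimodule.{v} R B A) : Set M.carrier :=
  {m | ∃ t : RTensor R D M.carrier, ∀ b, M.lact b m = (Q.κ b).eval t}

/-- `M` is `(D, C)`-birational: `M` equals the intersection of its `D`-rational and its
`C`-rational part. -/
def RingBimodule.IsBirational : ObjectProperty (RingBimodule.{v} R B A) := fun M =>
  M.leftRat Q ∩ M.rightRat P = Set.univ

/-- The objects of the category of `(D, C)`-birational `(B, A)`-faithful `(B, A)`-bimodules. -/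
def RingBimodule.IsFaithfulBirational : ObjectProperty (RingBimodule.{v} R B A) :=
  RingBimodule.IsFaithful R B A ⊓ RingBimodule.IsBirational P Q

/-- The objects of the category of `(D, C)`-birational unital `(B, A)`-bimodules. Faithfulness is
not demanded here; an equality with `IsFaithfulBirational` says that a birational bimodule is
faithful if and only if it is unital. -/
def RingBimodule.IsUnitalBirational : ObjectProperty (RingBimodule.{v} R B A) :=
  RingBimodule.IsUnital R B A ⊓ RingBimodule.IsBirational P Q

/-- The `(B, A)`-bimodule induced by a bicomodule, with actions `m a = ∑ m₀ ⟨a, m₁⟩` and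
`b m = ∑ ⟨b, m₋₁⟩ m₀`. -/
def Bicomodule.toRingBimodule (M : Bicomodule.{v} R D C) : RingBimodule.{v} R B A where
  toRBimodule := M.toRBimodule
  ract := AddMonoidHom.mk' (fun m => AddMonoidHom.mk' (fun a => (P.κ a).eval (M.rcoact m))
      (fun a a' => by rw [map_add, LeftDual.add_eval]))
    (fun m m' => by ext a; simp)
  ract_mul m a a' := by
    have := LeftDual.eval_eval M.rcoact.right M.rcoassoc (P.κ a) (P.κ a') m
    simpa [P.map_mul] using this.symm
  ract_balanced m r a := by simp [LeftDual.eval_op_smul]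
  ract_op_smul m r a := by simp [LeftDual.op_smul_eval]
  ract_smul m r a := by simp [LeftDual.eval_smul]
  lact := AddMonoidHom.mk' (fun b => (Q.κ b).eval.comp M.lcoact.left.toAddMonoidHom)
    (fun b b' => by ext m; simp [RightDual.add_eval])
  lact_mul b b' m := by
    have := RightDual.eval_eval M.lcoact.left M.lcoassoc (Q.κ b) (Q.κ b') m
    simpa [Q.map_mul] using this.symm
  lact_balanced b r m := by simp [RightDual.eval_smul]
  lact_smul b r m := by simp [RightDual.smul_eval]
  lact_op_smul b r m := by simp [RightDual.eval_op_smul]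
  lact_ract b m a := by
    have h1 : ∀ x : RTensor R M.carrier C, (P.κ a).eval ((Q.κ b).eval
        (RTensor.assoc R D M.carrier C (RTensor.map M.lcoact.right LinearMap.id x))) =
        (Q.κ b).eval (M.lcoact ((P.κ a).eval x)) := by
      intro x
      induction x using RTensor.induction_on with
      | zero => simp
      | tmul m c =>
        simp only [RTensor.map_tmul, BimodMap.right_apply, LinearMap.id_apply,
          LeftDual.eval_tmul, BimodMap.map_smul_right, RightDual.eval_op_smul]
        generalize M.lcoact m = y
        induction y using RTensor.induction_on with
        | zero => simp [RTensor.zero_tmul]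
        | tmul d n => simp
        | add x y hx hy => simp only [RTensor.add_tmul, map_add, smul_add, hx, hy]
      | add x y hx hy => simp only [map_add, hx, hy]
    have h2 := h1 (M.rcoact m)
    rw [M.compat, RightDual.eval_map] at h2
    exact h2

/-- The functor `M ↦ (M, induced actions)`, the identity on underlying maps. -/
def Bicomodule.toRingBimoduleFunctor :
    Bicomodule.{v} R D C ⥤ RingBimodule.{v} R B A where
  obj M := M.toRingBimodule P Q
  map {M N} f :=
    { toMap := f.toMap
      map_ract := fun m a => by
        exact ((congrArg (P.κ a).eval (f.rcolinear m)).trans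
          (LeftDual.eval_map (P.κ a) f.toMap.right (M.rcoact m))).symm
      map_lact := fun b m => by
        exact ((congrArg (Q.κ b).eval (f.lcolinear m)).trans
          (RightDual.eval_map (Q.κ b) f.toMap.left (M.lcoact m))).symm }

end birational

/-! ## Local dual bases and separation of tensors -/

/-! Everything rests on one separation principle: an element `t` of `M ⊗_R C` is determined by the
values `∑ mᵢ ⟨a, cᵢ⟩` with `a ∈ A`, and symmetrically an element of `D ⊗_R M` by the values at `b ∈
B`. It has two ingredients. Local projectivity gives a dual basis on a finitely generated submodule
containing the second tensor factors, so a tensor killed by all of `*C` vanishes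
(`LeftDual.eval_injective`). Density lets an element of `A` imitate a given functional on the
finitely many elements of `C` occurring in a given tensor
(`MeasuringLeftPairing.IsDense.exists_eval_eq`). Together these give
`MeasuringLeftPairing.IsDense.separates`.

Separation turns identities between coactions into identities between actions. The tensors whose
existence birationality asserts are unique, hence they depend `R`-bilinearly on `m`. Coassociativity
of the resulting coactions becomes associativity of the actions, and their compatibility becomes `(b
m) a = b (m a)`. So every birational bimodule comes from a bicomodule, on the nose
(`RingBimodule.IsBirational.exists_toRingBimodule_eq`). By the same principle this bicomodule is
unique and linear maps are colinear, so the functor induced by the pairings is fully faithful and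
injective on objects.

It remains to match the side conditions. Faithfulness of the actions is injectivity of the
coactions, again by separation. Unitality is compared with injectivity through the counit `ε`, which
is the unit of both dual rings: the coaction `ρ` is injective exactly when `ε` fixes every `m`, that
is `∑ m₀ ε(m₁) = m`. This holds when `M A = M`, because `κ(a) ⋆ ε = κ(a)`. Conversely, density
provides for each `m` an `a` acting on `m` as `ε` does, so that `m = m a`. Thus faithful and unital
agree on birational bimodules. -/

theorem IsLocallyProjective.exists_dualBasis {S W : Type u} [Ring S] [AddCommGroup W] [Module S W]
    (h : IsLocallyProjective S W) (F : Submodule S W) (hF : F.FG) :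
    ∃ g : W →ₗ[S] (W →₀ S), ∀ x ∈ F, ((g x).sum fun w s => s • w) = x := by
  -- The identity of `W` is lifted on `F` through the free module on all elements of `W`. Since `S`
  -- and `W` share a universe, `W` and `W →₀ S` may serve directly as test modules.
  obtain ⟨g, hg⟩ := h (W →₀ S) W (Finsupp.linearCombination S (id : W → W))
    (Finsupp.linearCombination_id_surjective S W) LinearMap.id F hF
  exact ⟨g, fun x hx => hg x hx⟩

namespace RTensor

variable {R M N : Type*} [Ring R] [AddCommGroup M] [AddCommGroup N] [Module Rᵐᵒᵖ M] [Module R N]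

theorem tmul_sum {ι : Type*} (s : Finset ι) (m : M) (n : ι → N) :
    tmul R m (∑ i ∈ s, n i) = ∑ i ∈ s, tmul R m (n i) :=
  map_sum (mkHom R M N m) n s

theorem sum_tmul {ι : Type*} (s : Finset ι) (m : ι → M) (n : N) :
    tmul R (∑ i ∈ s, m i) n = ∑ i ∈ s, tmul R (m i) n :=
  map_sum ((mkHom R M N).flip n) m s

theorem exists_sum_tmul (t : RTensor R M N) :
    ∃ (n : ℕ) (x : Fin n → M) (y : Fin n → N), t = ∑ i, tmul R (x i) (y i) := by
  induction t using RTensor.induction_on with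
  | zero => exact ⟨0, Fin.elim0, Fin.elim0, by simp⟩
  | tmul m n => exact ⟨1, fun _ => m, fun _ => n, by simp⟩
  | add s t hs ht =>
    obtain ⟨k, x, y, rfl⟩ := hs
    obtain ⟨l, x', y', rfl⟩ := ht
    exact ⟨k + l, Fin.append x x', Fin.append y y', by simp [Fin.sum_univ_add]⟩

/-- Used to move a tensor of `M ⊗ (C ⊗ C)` to the bracketing `(M ⊗ C) ⊗ C`, where functionals on `C`
can be applied one after the other. An equality proved there is then pushed forward along `assoc`,
so injectivity of `assoc` is not needed. -/
theorem assoc_surjective (R M N P : Type*) [Ring R] [AddCommGroup M] [AddCommGroup N]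
    [AddCommGroup P] [Module Rᵐᵒᵖ M] [Module R N] [Module Rᵐᵒᵖ N] [SMulCommClass R Rᵐᵒᵖ N]
    [Module R P] : Function.Surjective (assoc R M N P) := by
  intro t
  induction t using RTensor.induction_on with
  | zero => exact ⟨0, map_zero _⟩
  | tmul m y =>
    induction y using RTensor.induction_on with
    | zero => exact ⟨0, by rw [map_zero, tmul_zero]⟩
    | tmul n p => exact ⟨tmul R (tmul R m n) p, rfl⟩
    | add x y hx hy =>
      obtain ⟨a, ha⟩ := hx
      obtain ⟨b, hb⟩ := hy
      exact ⟨a + b, by rw [map_add, ha, hb, tmul_add]⟩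
  | add x y hx hy =>
    obtain ⟨a, ha⟩ := hx
    obtain ⟨b, hb⟩ := hy
    exact ⟨a + b, by rw [map_add, ha, hb]⟩

end RTensor

/-- With a dual basis `(c_w, w)` valid on the span of the `yᵢ`, balancing gives `∑ xᵢ ⊗ yᵢ = ∑_w (∑ᵢ
xᵢ c_w(yᵢ)) ⊗ w`. The inner sums are the evaluations of the tensor at the functionals `c_w`, so they
vanish. -/
theorem LeftDual.eval_injective {R W : Type u} {M : Type*} [Ring R] [AddCommGroup W] [Module R W]
    [AddCommGroup M] [Module Rᵐᵒᵖ M] (hW : IsLocallyProjective R W) {s t : RTensor R M W}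
    (h : ∀ f : LeftDual R W, f.eval s = f.eval t) : s = t := by
  rw [← sub_eq_zero]
  replace h : ∀ f : LeftDual R W, f.eval (s - t) = 0 := fun f => by rw [map_sub, h, sub_self]
  obtain ⟨n, x, y, e⟩ := RTensor.exists_sum_tmul (s - t)
  rw [e] at h ⊢
  obtain ⟨g, hg⟩ := hW.exists_dualBasis (Submodule.span R (Set.range y))
    (Submodule.fg_span (Set.finite_range y))
  let c (w : W) : LeftDual R W := (Finsupp.lapply w).comp g
  classical
  -- A common finite index set for the expansions of all `yᵢ`, so that the two sums can be
  -- interchanged.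
  let T : Finset W := Finset.univ.biUnion fun i => (g (y i)).support
  have key : ∀ i, y i = ∑ w ∈ T, c w (y i) • w := fun i => by
    conv_lhs => rw [← hg (y i) (Submodule.subset_span ⟨i, rfl⟩)]
    exact Finsupp.sum_of_support_subset _
      (Finset.subset_biUnion_of_mem (fun i => (g (y i)).support) (Finset.mem_univ i)) _
      (fun w _ => zero_smul R w)
  calc ∑ i, RTensor.tmul R (x i) (y i)
      = ∑ i, ∑ w ∈ T, RTensor.tmul R (op (c w (y i)) • x i) w := by
        refine Finset.sum_congr rfl fun i _ => ?_
        conv_lhs => rw [key i]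
        rw [RTensor.tmul_sum]
        exact Finset.sum_congr rfl fun w _ => (RTensor.smul_tmul _ _ _).symm
    _ = ∑ w ∈ T, RTensor.tmul R ((c w).eval (∑ i, RTensor.tmul R (x i) (y i))) w := by
        rw [Finset.sum_comm]
        refine Finset.sum_congr rfl fun w _ => ?_
        rw [map_sum, RTensor.sum_tmul]
        rfl
    _ = 0 := by simp [h, RTensor.zero_tmul]

theorem RightDual.eval_injective {R W : Type u} {M : Type*} [Ring R] [AddCommGroup W]
    [Module Rᵐᵒᵖ W] [AddCommGroup M] [Module R M] (hW : IsLocallyProjective Rᵐᵒᵖ W)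
    {s t : RTensor R W M} (h : ∀ f : RightDual R W, f.eval s = f.eval t) : s = t := by
  rw [← sub_eq_zero]
  replace h : ∀ f : RightDual R W, f.eval (s - t) = 0 := fun f => by rw [map_sub, h, sub_self]
  obtain ⟨n, y, x, e⟩ := RTensor.exists_sum_tmul (s - t)
  rw [e] at h ⊢
  obtain ⟨g, hg⟩ := hW.exists_dualBasis (Submodule.span Rᵐᵒᵖ (Set.range y))
    (Submodule.fg_span (Set.finite_range y))
  -- The dual basis over `Rᵐᵒᵖ` has coordinates in `Rᵐᵒᵖ` as a left module over itself. This is `R`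
  -- as a right module over itself, and `unop` is the identification that turns the coordinates into
  -- elements of `W*`.
  let unopHom : Rᵐᵒᵖ →ₗ[Rᵐᵒᵖ] R :=
    { toFun := unop
      map_add' := fun _ _ => rfl
      map_smul' := fun _ _ => rfl }
  let c (w : W) : RightDual R W := unopHom.comp ((Finsupp.lapply w).comp g)
  classical
  let T : Finset W := Finset.univ.biUnion fun i => (g (y i)).support
  have key : ∀ i, y i = ∑ w ∈ T, op (c w (y i)) • w := fun i => by
    conv_lhs => rw [← hg (y i) (Submodule.subset_span ⟨i, rfl⟩)]
    exact Finsupp.sum_of_support_subset _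
      (Finset.subset_biUnion_of_mem (fun i => (g (y i)).support) (Finset.mem_univ i)) _
      (fun w _ => zero_smul Rᵐᵒᵖ w)
  calc ∑ i, RTensor.tmul R (y i) (x i)
      = ∑ i, ∑ w ∈ T, RTensor.tmul R w (c w (y i) • x i) := by
        refine Finset.sum_congr rfl fun i _ => ?_
        conv_lhs => rw [key i]
        rw [RTensor.sum_tmul]
        exact Finset.sum_congr rfl fun w _ => RTensor.smul_tmul _ _ _
    _ = ∑ w ∈ T, RTensor.tmul R w ((c w).eval (∑ i, RTensor.tmul R (y i) (x i))) := by
        rw [Finset.sum_comm]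
        refine Finset.sum_congr rfl fun w _ => ?_
        rw [map_sum, RTensor.tmul_sum]
        rfl
    _ = 0 := by simp [h, RTensor.tmul_zero]

/-- A set of functions that is dense for the topology induced from a product of discrete spaces
contains a function with any attained values at finitely many points. -/
theorem exists_mem_eqOn_of_dense_induced {X U Y : Type*} (φ : X → U → Y) (s : Set X)
    (hs : @Dense X (TopologicalSpace.induced φ (@Pi.topologicalSpace U (fun _ => Y) fun _ => ⊥)) s)
    (x : X) (F : Set U) (hF : F.Finite) : ∃ y ∈ s, ∀ u ∈ F, φ y u = φ x u := by
  let _ : TopologicalSpace Y := ⊥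
  have _ : DiscreteTopology Y := ⟨rfl⟩
  let _ : TopologicalSpace X := TopologicalSpace.induced φ Pi.topologicalSpace
  -- The functions agreeing with `φ x` at the finitely many points of `F` form a basic open box,
  -- because `Y` is discrete.
  have hO : IsOpen (φ ⁻¹' (F.pi fun u => {φ x u})) :=
    (isOpen_set_pi hF fun _ _ => isOpen_discrete _).preimage continuous_induced_dom
  obtain ⟨y, hy, hys⟩ := hs.inter_open_nonempty _ hO ⟨x, fun u _ => rfl⟩
  exact ⟨y, hys, fun u hu => hy u hu⟩

/-! ### Density as interpolation of functionals on a given tensor -/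

section pairings

variable {R A B C D : Type*} [Ring R]
  [NonUnitalRing A] [Module R A] [Module Rᵐᵒᵖ A] [IsRRing R A]
  [NonUnitalRing B] [Module R B] [Module Rᵐᵒᵖ B] [IsRRing R B]
  [AddCommGroup C] [Module R C] [Module Rᵐᵒᵖ C] [SMulCommClass R Rᵐᵒᵖ C] [RCoring R C]
  [AddCommGroup D] [Module R D] [Module Rᵐᵒᵖ D] [SMulCommClass R Rᵐᵒᵖ D] [RCoring R D]

/-- A tensor involves only finitely many elements of `C`, and density yields an `a` whose functional
agrees with `f` on them. The choice of `a` depends on `t`. -/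
theorem MeasuringLeftPairing.IsDense.exists_eval_eq {P : MeasuringLeftPairing R A C}
    (hP : P.IsDense) {M : Type*} [AddCommGroup M] [Module Rᵐᵒᵖ M] (f : LeftDual R C)
    (t : RTensor R M C) : ∃ a, (P.κ a).eval t = f.eval t := by
  obtain ⟨n, x, y, rfl⟩ := RTensor.exists_sum_tmul t
  obtain ⟨_, ⟨a, rfl⟩, ha⟩ := exists_mem_eqOn_of_dense_induced (fun f : LeftDual R C => (f : C → R))
    (Set.range P.κ) hP f _ (Set.finite_range y)
  refine ⟨a, ?_⟩
  rw [map_sum, map_sum]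
  exact Finset.sum_congr rfl fun i _ => by simp only [LeftDual.eval_tmul, ha _ ⟨i, rfl⟩]

theorem MeasuringRightPairing.IsDense.exists_eval_eq {Q : MeasuringRightPairing R B D}
    (hQ : Q.IsDense) {M : Type*} [AddCommGroup M] [Module R M] (f : RightDual R D)
    (t : RTensor R D M) : ∃ b, (Q.κ b).eval t = f.eval t := by
  obtain ⟨n, y, x, rfl⟩ := RTensor.exists_sum_tmul t
  obtain ⟨_, ⟨b, rfl⟩, hb⟩ := exists_mem_eqOn_of_dense_induced
    (fun f : RightDual R D => (f : D → R)) (Set.range Q.κ) hQ f _ (Set.finite_range y)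
  refine ⟨b, ?_⟩
  rw [map_sum, map_sum]
  exact Finset.sum_congr rfl fun i _ => by simp only [RightDual.eval_tmul, hb _ ⟨i, rfl⟩]

theorem LeftDual.pairing_isDense (R C : Type*) [Ring R] [AddCommGroup C] [Module R C]
    [Module Rᵐᵒᵖ C] [SMulCommClass R Rᵐᵒᵖ C] [RCoring R C] : (LeftDual.pairing R C).IsDense :=
  @Function.Surjective.denseRange _ (LeftDual.finiteTopology R C) _ _ fun f => ⟨f, rfl⟩

theorem RightDual.pairing_isDense (R D : Type*) [Ring R] [AddCommGroup D] [Module R D]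
    [Module Rᵐᵒᵖ D] [SMulCommClass R Rᵐᵒᵖ D] [RCoring R D] : (RightDual.pairing R D).IsDense :=
  @Function.Surjective.denseRange _ (RightDual.finiteTopology R D) _ _ fun f => ⟨f, rfl⟩

end pairings

/-! ### Separation of tensors by the rings of the pairings -/

section separation

variable {R C D : Type u} {A B : Type*} [Ring R]
  [NonUnitalRing A] [Module R A] [Module Rᵐᵒᵖ A] [IsRRing R A]
  [NonUnitalRing B] [Module R B] [Module Rᵐᵒᵖ B] [IsRRing R B]
  [AddCommGroup C] [Module R C] [Module Rᵐᵒᵖ C] [SMulCommClass R Rᵐᵒᵖ C] [RCoring R C]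
  [AddCommGroup D] [Module R D] [Module Rᵐᵒᵖ D] [SMulCommClass R Rᵐᵒᵖ D] [RCoring R D]

/-- `A` separates the elements of `M ⊗_R C` (the `α`-condition). -/
theorem MeasuringLeftPairing.IsDense.separates {P : MeasuringLeftPairing R A C} (hP : P.IsDense)
    (hC : IsLocallyProjective R C) {M : Type*} [AddCommGroup M] [Module Rᵐᵒᵖ M]
    {s t : RTensor R M C} (h : ∀ a, (P.κ a).eval s = (P.κ a).eval t) : s = t := by
  rw [← sub_eq_zero]
  -- The element `a` imitating `f` is adapted to a single tensor, so it is chosen for the difference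
  -- `s - t`.
  refine LeftDual.eval_injective hC fun f => ?_
  obtain ⟨a, ha⟩ := hP.exists_eval_eq f (s - t)
  rw [← ha, map_sub, h, sub_self, map_zero]

/-- `B` separates the elements of `D ⊗_R M`. -/
theorem MeasuringRightPairing.IsDense.separates {Q : MeasuringRightPairing R B D} (hQ : Q.IsDense)
    (hD : IsLocallyProjective Rᵐᵒᵖ D) {M : Type*} [AddCommGroup M] [Module R M]
    {s t : RTensor R D M} (h : ∀ b, (Q.κ b).eval s = (Q.κ b).eval t) : s = t := by
  rw [← sub_eq_zero]
  refine RightDual.eval_injective hD fun f => ?_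
  obtain ⟨b, hb⟩ := hQ.exists_eval_eq f (s - t)
  rw [← hb, map_sub, h, sub_self, map_zero]

end separation

/-! ## Coassociativity from associativity of the induced actions -/

/-- `m ⊗ (c ⊗ d) ↦ m g(c f(d))`. -/
def LeftDual.eval₂ {R M C : Type*} [Ring R] [AddCommGroup M] [AddCommGroup C] [Module Rᵐᵒᵖ M]
    [Module R C] [Module Rᵐᵒᵖ C] [SMulCommClass R Rᵐᵒᵖ C] (f g : LeftDual R C) :
    RTensor R M (RTensor R C C) →+ M :=
  RTensor.lift (AddMonoidHom.mk' (fun m => AddMonoidHom.mk' (fun x => op (g (f.eval x)) • m)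
      (fun w w' => by rw [map_add, map_add, MulOpposite.op_add, add_smul]))
    (fun m m' => by ext w; exact smul_add _ m m'))
    (fun m r w => by simp [LeftDual.eval_smul, mul_smul])

/-- In `M ⊗ (C ⊗ C)` no functional can be applied to the outer factor `C ⊗ C` alone in the form used
for `M ⊗ C`. This identity shows that `eval₂` is the iterated evaluation seen through the other
bracketing. -/
theorem LeftDual.eval₂_assoc {R M C : Type*} [Ring R] [AddCommGroup M] [AddCommGroup C]
    [Module Rᵐᵒᵖ M] [Module R C] [Module Rᵐᵒᵖ C] [SMulCommClass R Rᵐᵒᵖ C] (f g : LeftDual R C)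
    (z : RTensor R (RTensor R M C) C) :
    f.eval₂ g (RTensor.assoc R M C C z) = g.eval (f.eval z) := by
  induction z using RTensor.induction_on with
  | zero => simp
  | tmul y c =>
    induction y using RTensor.induction_on with
    | zero => simp [RTensor.zero_tmul]
    | tmul m d => rfl
    | add x y hx hy => simp only [RTensor.add_tmul, map_add, hx, hy]
  | add x y hx hy => simp only [map_add, hx, hy]

theorem LeftDual.eval₂_map_comul {R M C : Type*} [Ring R] [AddCommGroup M] [AddCommGroup C]
    [Module Rᵐᵒᵖ M] [Module R C] [Module Rᵐᵒᵖ C] [SMulCommClass R Rᵐᵒᵖ C] [RCoring R C]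
    (f g : LeftDual R C) (x : RTensor R M C) :
    f.eval₂ g (RTensor.map LinearMap.id (RCoring.comul (R := R) (C := C)).left x) =
      (f * g).eval x := by
  induction x using RTensor.induction_on with
  | zero => simp
  | tmul m c => rfl
  | add x y hx hy => simp only [map_add, hx, hy]

/-- On pure tensors, evaluating `c ⊗ (d ⊗ m)` first at `g` and then at `f` gives `f(g(c) d) m`,
which is the pattern of the product of `D*`. Here the bracketing `D ⊗ (D ⊗ M)` already allows
iterated evaluation, so no analogue of `eval₂` is required. -/
theorem RightDual.eval_eval_assoc_map_comul {R M D : Type*} [Ring R] [AddCommGroup M]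
    [AddCommGroup D] [Module R M] [Module R D] [Module Rᵐᵒᵖ D] [SMulCommClass R Rᵐᵒᵖ D]
    [RCoring R D] (f g : RightDual R D) (x : RTensor R D M) :
    f.eval (g.eval (RTensor.assoc R D D M
      (RTensor.map (RCoring.comul (R := R) (C := D)).right LinearMap.id x))) = (f * g).eval x := by
  have h (y : RTensor R D D) (m : M) :
      f.eval (g.eval (RTensor.assoc R D D M (RTensor.tmul R y m))) = f (g.eval y) • m := by
    induction y using RTensor.induction_on with
    | zero => simp [RTensor.zero_tmul]
    | tmul c d => rfl
    | add x y hx hy => simp only [RTensor.add_tmul, map_add, add_smul, hx, hy]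
  induction x using RTensor.induction_on with
  | zero => simp
  | tmul d m => exact h _ m
  | add x y hx hy => simp only [map_add, hx, hy]

/-- Functionals on `D` and on `C` act on opposite ends of `D ⊗ M ⊗ C`, so their order is immaterial.
This reduces compatibility of the two coactions to commutation of the two actions. -/
theorem LeftDual.eval_eval_assoc_map {R M C D : Type*} [Ring R] [AddCommGroup M] [Module R M]
    [Module Rᵐᵒᵖ M] [SMulCommClass R Rᵐᵒᵖ M] [AddCommGroup C] [Module R C] [AddCommGroup D]
    [Module Rᵐᵒᵖ D] (f : LeftDual R C) (g : RightDual R D)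
    (l : M →ₗ[Rᵐᵒᵖ] RTensor R D M) (x : RTensor R M C) :
    f.eval (g.eval (RTensor.assoc R D M C (RTensor.map l LinearMap.id x))) =
      g.eval (l (f.eval x)) := by
  induction x using RTensor.induction_on with
  | zero => simp
  | tmul m c =>
    simp only [RTensor.map_tmul, LinearMap.id_apply, LeftDual.eval_tmul, map_smul,
      RightDual.eval_op_smul]
    generalize l m = y
    induction y using RTensor.induction_on with
    | zero => simp [RTensor.zero_tmul]
    | tmul d n => simp
    | add x y hx hy => simp only [RTensor.add_tmul, map_add, smul_add, hx, hy]
  | add x y hx hy => simp only [map_add, hx, hy]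

section birational

variable {R C D : Type u} {A B : Type*} [Ring R]
  [NonUnitalRing A] [Module R A] [Module Rᵐᵒᵖ A] [IsRRing R A]
  [NonUnitalRing B] [Module R B] [Module Rᵐᵒᵖ B] [IsRRing R B]
  [AddCommGroup C] [Module R C] [Module Rᵐᵒᵖ C] [SMulCommClass R Rᵐᵒᵖ C] [RCoring R C]
  [AddCommGroup D] [Module R D] [Module Rᵐᵒᵖ D] [SMulCommClass R Rᵐᵒᵖ D] [RCoring R D]
  {P : MeasuringLeftPairing R A C} {Q : MeasuringRightPairing R B D}

theorem MeasuringLeftPairing.IsDense.coassoc (hP : P.IsDense) (hC : IsLocallyProjective R C)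
    {M : Type*} [AddCommGroup M] [Module Rᵐᵒᵖ M] (ρ : M →ₗ[Rᵐᵒᵖ] RTensor R M C)
    (h : ∀ m a a', (P.κ a').eval (ρ ((P.κ a).eval (ρ m))) = (P.κ (a * a')).eval (ρ m)) (m : M) :
    RTensor.assoc R M C C (RTensor.map ρ LinearMap.id (ρ m)) =
      RTensor.map LinearMap.id (RCoring.comul (R := R) (C := C)).left (ρ m) := by
  obtain ⟨z, hz⟩ := RTensor.assoc_surjective R M C C
    (RTensor.map LinearMap.id (RCoring.comul (R := R) (C := C)).left (ρ m))
  rw [← hz]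
  -- It suffices to compare with the lift `z` in `(M ⊗ C) ⊗ C`. Separating first the outer and then
  -- the inner factor `C` leaves `(m a) a' = m (a a')`.
  refine congrArg _ (hP.separates hC fun a => hP.separates hC fun a' => ?_)
  rw [← LeftDual.eval₂_assoc _ _ z, hz, LeftDual.eval₂_map_comul, LeftDual.eval_map, h, P.map_mul]

theorem MeasuringRightPairing.IsDense.coassoc (hQ : Q.IsDense) (hD : IsLocallyProjective Rᵐᵒᵖ D)
    {M : Type*} [AddCommGroup M] [Module R M] (l : M →ₗ[R] RTensor R D M)
    (h : ∀ m b b', (Q.κ b).eval (l ((Q.κ b').eval (l m))) = (Q.κ (b * b')).eval (l m)) (m : M) :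
    RTensor.assoc R D D M
        (RTensor.map (RCoring.comul (R := R) (C := D)).right LinearMap.id (l m)) =
      RTensor.map LinearMap.id l (l m) := by
  refine hQ.separates hD fun b' => hQ.separates hD fun b => ?_
  rw [RightDual.eval_eval_assoc_map_comul, RightDual.eval_map, h, Q.map_mul]

/-! ## The bicomodule of a birational bimodule -/

/-- Separation makes the tensor representing the action on `m` unique, so arbitrary choices assemble
to a bilinear map. Right linearity comes from balancedness, `(m r) a = m (r a)`, together with left
linearity of `κ`. -/
theorem RingBimodule.IsBirational.exists_rcoact {M : RingBimodule.{v} R B A}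
    (hM : RingBimodule.IsBirational P Q M) (hP : P.IsDense) (hC : IsLocallyProjective R C) :
    ∃ ρ : BimodMap R M.carrier (RTensor R M.carrier C),
      ∀ m a, (P.κ a).eval (ρ m) = M.ract m a := by
  have h (m : M.carrier) : ∃ t : RTensor R M.carrier C, ∀ a, M.ract m a = (P.κ a).eval t :=
    ((Set.ext_iff.1 hM m).2 trivial).2
  choose ρ hρ using h
  have hadd (m m' : M.carrier) : ρ (m + m') = ρ m + ρ m' := hP.separates hC fun a => by
    rw [map_add, ← hρ (m + m') a, ← hρ m a, ← hρ m' a, map_add, AddMonoidHom.add_apply]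
  have hsmul (r : R) (m : M.carrier) : ρ (r • m) = r • ρ m := hP.separates hC fun a => by
    rw [LeftDual.eval_smul, ← hρ (r • m) a, ← hρ m a, M.ract_smul]
  have hop (r : R) (m : M.carrier) : ρ (op r • m) = op r • ρ m := hP.separates hC fun a => by
    rw [LeftDual.eval_op_smul, ← P.κ.map_smul_left r a, ← hρ (op r • m) a, ← hρ m (r • a),
      M.ract_balanced]
  exact ⟨⟨⟨⟨ρ, hadd⟩, hsmul⟩, fun r m => hop r.unop m⟩, fun m a => (hρ m a).symm⟩

theorem RingBimodule.IsBirational.exists_lcoact {M : RingBimodule.{v} R B A}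
    (hM : RingBimodule.IsBirational P Q M) (hQ : Q.IsDense) (hD : IsLocallyProjective Rᵐᵒᵖ D) :
    ∃ l : BimodMap R M.carrier (RTensor R D M.carrier),
      ∀ m b, (Q.κ b).eval (l m) = M.lact b m := by
  have h (m : M.carrier) : ∃ t : RTensor R D M.carrier, ∀ b, M.lact b m = (Q.κ b).eval t :=
    ((Set.ext_iff.1 hM m).2 trivial).1
  choose l hl using h
  have hadd (m m' : M.carrier) : l (m + m') = l m + l m' := hQ.separates hD fun b => by
    rw [map_add, ← hl (m + m') b, ← hl m b, ← hl m' b, map_add]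
  have hsmul (r : R) (m : M.carrier) : l (r • m) = r • l m := hQ.separates hD fun b => by
    rw [RightDual.eval_smul, ← Q.κ.map_smul_right (op r) b, ← hl (r • m) b, ← hl m (op r • b),
      M.lact_balanced]
  have hop (r : R) (m : M.carrier) : l (op r • m) = op r • l m := hQ.separates hD fun b => by
    rw [RightDual.eval_op_smul, ← hl (op r • m) b, ← hl m b, M.lact_op_smul]
  exact ⟨⟨⟨⟨l, hadd⟩, hsmul⟩, fun r m => hop r.unop m⟩, fun m b => (hl m b).symm⟩

theorem RingBimodule.IsBirational.exists_toRingBimodule_eq {M : RingBimodule.{v} R B A}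
    (hM : RingBimodule.IsBirational P Q M) (hP : P.IsDense) (hQ : Q.IsDense)
    (hC : IsLocallyProjective R C) (hD : IsLocallyProjective Rᵐᵒᵖ D) :
    ∃ X : Bicomodule.{v} R D C, X.toRingBimodule P Q = M := by
  obtain ⟨ρ, hρ⟩ := hM.exists_rcoact hP hC
  obtain ⟨l, hl⟩ := hM.exists_lcoact hQ hD
  refine ⟨
    { toRBimodule := M.toRBimodule
      rcoact := ρ
      rcoassoc := hP.coassoc hC ρ.right fun m a a' => by
        simp only [BimodMap.right_apply, hρ, M.ract_mul]
      lcoact := l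
      lcoassoc := hQ.coassoc hD l.left fun m b b' => by
        simp only [BimodMap.left_apply, hl, M.lact_mul]
      -- Both sides lie in `D ⊗ (M ⊗ C)`; evaluated at `b` and then at `a` they become `b (m a)` and
      -- `(b m) a`.
      compat := fun m => hQ.separates hD fun b => hP.separates hC fun a => by
        rw [LeftDual.eval_eval_assoc_map, RightDual.eval_map, BimodMap.right_apply,
          BimodMap.left_apply, hl, hρ, hl, hρ, M.lact_ract] }, ?_⟩
  -- An isomorphism of categories needs equality of objects. The types of the actions depend on the
  -- underlying bimodule, hence the heterogeneous equalities; they become ordinary ones once the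
  -- bimodules are identified.
  have eq_of (X : Bicomodule.{v} R D C) (M : RingBimodule.{v} R B A)
      (h : X.toRBimodule = M.toRBimodule) (h1 : HEq (X.toRingBimodule P Q).ract M.ract)
      (h2 : HEq (X.toRingBimodule P Q).lact M.lact) : X.toRingBimodule P Q = M := by
    obtain ⟨V, _, _, _, _, _, _, _, _, _, _, _⟩ := M
    obtain rfl : X.toRBimodule = V := h
    obtain rfl := eq_of_heq h1
    obtain rfl := eq_of_heq h2
    rfl
  exact eq_of _ _ rfl (heq_of_eq (AddMonoidHom.ext fun m => AddMonoidHom.ext fun a => hρ m a))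
    (heq_of_eq (AddMonoidHom.ext fun b => AddMonoidHom.ext fun m => hl m b))

theorem Bicomodule.toRingBimodule_isBirational (X : Bicomodule.{v} R D C) :
    RingBimodule.IsBirational P Q (X.toRingBimodule P Q) :=
  Set.eq_univ_of_forall fun m => ⟨⟨X.lcoact m, fun _ => rfl⟩, ⟨X.rcoact m, fun _ => rfl⟩⟩

/-! ## Counital, faithful and unital -/

/-- By separation, two elements have the same coaction exactly when every element of the ring acts
on them in the same way. -/
theorem Bicomodule.toRingBimodule_isFaithful_iff (hP : P.IsDense) (hQ : Q.IsDense)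
    (hC : IsLocallyProjective R C) (hD : IsLocallyProjective Rᵐᵒᵖ D) (X : Bicomodule.{v} R D C) :
    RingBimodule.IsFaithful R B A (X.toRingBimodule P Q) ↔ Bicomodule.IsCounital R D C X := by
  refine and_congr ⟨fun h m m' e => h ?_, fun h m m' e => h ?_⟩
    ⟨fun h m m' e => h ?_, fun h m m' e => h ?_⟩
  · funext a; exact congrArg (P.κ a).eval e
  · exact hP.separates hC fun a => congrFun e a
  · funext b; exact congrArg (Q.κ b).eval e
  · exact hQ.separates hD fun b => congrFun e b

end birational

/-! ### The counit as two-sided unit of both dual rings -/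

section counit

variable (R : Type*) {C : Type*} [Ring R] [AddCommGroup C] [Module R C] [Module Rᵐᵒᵖ C]
  [SMulCommClass R Rᵐᵒᵖ C] [RCoring R C]

variable (C) in
/-- The counit as an element of `*C`. -/
def LeftDual.counit : LeftDual R C := (RCoring.counit (R := R) (C := C)).left

variable (C) in
/-- The counit as an element of `C*`. -/
def RightDual.counit : RightDual R C := (RCoring.counit (R := R) (C := C)).right

theorem RCoring.counit_left_eval (c : C) :
    (RightDual.counit R C).eval (RCoring.comul (R := R) c) = c := by
  conv_rhs => rw [← RCoring.counit_left (R := R) c]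
  generalize RCoring.comul (R := R) c = x
  induction x using RTensor.induction_on with
  | zero => simp
  | tmul m c => rfl
  | add x y hx hy => simp only [map_add, hx, hy]

theorem RCoring.counit_right_eval (c : C) :
    (LeftDual.counit R C).eval (RCoring.comul (R := R) c) = c := by
  conv_rhs => rw [← RCoring.counit_right (R := R) c]
  generalize RCoring.comul (R := R) c = x
  induction x using RTensor.induction_on with
  | zero => simp
  | tmul m c => rfl
  | add x y hx hy => simp only [map_add, hx, hy]

theorem LeftDual.counit_mul (f : LeftDual R C) : LeftDual.counit R C * f = f := by
  ext c
  rw [LeftDual.mul_apply, RCoring.counit_right_eval]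

/-- Right linearity of `ε` and left linearity of `f` give `ε(c₁ f(c₂)) = ε(c₁) f(c₂) = f(ε(c₁) c₂)`,
so this side uses the left counit axiom, whereas `LeftDual.counit_mul` uses the right one. -/
theorem LeftDual.mul_counit (f : LeftDual R C) : f * LeftDual.counit R C = f := by
  ext c
  rw [LeftDual.mul_apply]
  conv_rhs => rw [← RCoring.counit_left_eval R c]
  generalize RCoring.comul (R := R) c = x
  induction x using RTensor.induction_on with
  | zero => simp
  | tmul c d =>
    rw [LeftDual.eval_tmul, RightDual.eval_tmul, map_smul f]
    exact (RCoring.counit (R := R) (C := C)).map_smul_right (op (f d)) c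
  | add x y hx hy => simp only [map_add, hx, hy]

theorem RightDual.mul_counit (f : RightDual R C) : f * RightDual.counit R C = f := by
  ext c
  rw [RightDual.mul_apply, RCoring.counit_left_eval]

theorem RightDual.counit_mul (f : RightDual R C) : RightDual.counit R C * f = f := by
  ext c
  rw [RightDual.mul_apply]
  conv_rhs => rw [← RCoring.counit_right_eval R c]
  generalize RCoring.comul (R := R) c = x
  induction x using RTensor.induction_on with
  | zero => simp
  | tmul c d =>
    rw [LeftDual.eval_tmul, RightDual.eval_tmul, map_smul f]
    exact (RCoring.counit (R := R) (C := C)).map_smul_left (f c) d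
  | add x y hx hy => simp only [map_add, hx, hy]

end counit

section birational

variable {R C D : Type u} {A B : Type*} [Ring R]
  [NonUnitalRing A] [Module R A] [Module Rᵐᵒᵖ A] [IsRRing R A]
  [NonUnitalRing B] [Module R B] [Module Rᵐᵒᵖ B] [IsRRing R B]
  [AddCommGroup C] [Module R C] [Module Rᵐᵒᵖ C] [SMulCommClass R Rᵐᵒᵖ C] [RCoring R C]
  [AddCommGroup D] [Module R D] [Module Rᵐᵒᵖ D] [SMulCommClass R Rᵐᵒᵖ D] [RCoring R D]
  {P : MeasuringLeftPairing R A C} {Q : MeasuringRightPairing R B D}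

/-- Since `ε ⋆ f = f`, the elements `m` and `∑ m₀ ε(m₁)` have coactions with equal values at every
`f`, hence equal coactions, and injectivity identifies the two elements. Conversely, evaluation at
`ε` is a left inverse of the coaction. Thus injectivity of the coaction is the usual counit axiom.
-/
theorem Bicomodule.rcoact_injective_iff (hC : IsLocallyProjective R C) (X : Bicomodule.{v} R D C) :
    Function.Injective X.rcoact ↔ ∀ m, (LeftDual.counit R C).eval (X.rcoact m) = m := by
  refine ⟨fun h m => h (LeftDual.eval_injective hC fun f => ?_), fun h => ?_⟩
  · have := LeftDual.eval_eval X.rcoact.right X.rcoassoc (LeftDual.counit R C) f m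
    rwa [LeftDual.counit_mul] at this
  · exact Function.LeftInverse.injective h

theorem Bicomodule.lcoact_injective_iff (hD : IsLocallyProjective Rᵐᵒᵖ D)
    (X : Bicomodule.{v} R D C) :
    Function.Injective X.lcoact ↔ ∀ m, (RightDual.counit R D).eval (X.lcoact m) = m := by
  refine ⟨fun h m => h (RightDual.eval_injective hD fun f => ?_), fun h => ?_⟩
  · have := RightDual.eval_eval X.lcoact.left X.lcoassoc f (RightDual.counit R D) m
    rwa [RightDual.mul_counit] at this
  · exact Function.LeftInverse.injective h

theorem Bicomodule.toRingBimodule_isUnital_iff (hP : P.IsDense) (hQ : Q.IsDense)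
    (hC : IsLocallyProjective R C) (hD : IsLocallyProjective Rᵐᵒᵖ D) (X : Bicomodule.{v} R D C) :
    RingBimodule.IsUnital R B A (X.toRingBimodule P Q) ↔ Bicomodule.IsCounital R D C X := by
  refine and_congr (Iff.trans ⟨fun h m => ?_, fun h => ?_⟩ (X.rcoact_injective_iff hC).symm)
    (Iff.trans ⟨fun h m => ?_, fun h => ?_⟩ (X.lcoact_injective_iff hD).symm)
  · let K : AddSubgroup X.carrier := ((LeftDual.counit R C).eval.comp
      X.rcoact.left.toAddMonoidHom).eqLocus (AddMonoidHom.id X.carrier)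
    have hK : K = ⊤ := by
      refine top_le_iff.1 (h.ge.trans ((AddSubgroup.closure_le K).2 ?_))
      rintro _ ⟨m, a, rfl⟩
      have := LeftDual.eval_eval X.rcoact.right X.rcoassoc (P.κ a) (LeftDual.counit R C) m
      rwa [LeftDual.mul_counit] at this
    exact hK.ge (AddSubgroup.mem_top m)
  · refine top_le_iff.1 fun m _ => AddSubgroup.subset_closure ?_
    -- Although `A` may lack a unit, density gives an `a` acting on this `m` as `ε` does, so `m = m
    -- a` is itself one of the generators.
    obtain ⟨a, ha⟩ := hP.exists_eval_eq (LeftDual.counit R C) (X.rcoact m)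
    exact ⟨m, a, ((ha.trans (h m)).symm :)⟩
  · let K : AddSubgroup X.carrier := ((RightDual.counit R D).eval.comp
      X.lcoact.left.toAddMonoidHom).eqLocus (AddMonoidHom.id X.carrier)
    have hK : K = ⊤ := by
      refine top_le_iff.1 (h.ge.trans ((AddSubgroup.closure_le K).2 ?_))
      rintro _ ⟨b, m, rfl⟩
      have := RightDual.eval_eval X.lcoact.left X.lcoassoc (RightDual.counit R D) (Q.κ b) m
      rwa [RightDual.counit_mul] at this
    exact hK.ge (AddSubgroup.mem_top m)
  · refine top_le_iff.1 fun m _ => AddSubgroup.subset_closure ?_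
    obtain ⟨b, hb⟩ := hQ.exists_eval_eq (RightDual.counit R D) (X.lcoact m)
    exact ⟨b, m, ((hb.trans (h m)).symm :)⟩

theorem RingBimodule.isFaithfulBirational_eq_isUnitalBirational (hP : P.IsDense) (hQ : Q.IsDense)
    (hC : IsLocallyProjective R C) (hD : IsLocallyProjective Rᵐᵒᵖ D) :
    RingBimodule.IsFaithfulBirational.{v} P Q = RingBimodule.IsUnitalBirational.{v} P Q := by
  funext M
  refine propext (and_congr_left fun hM => ?_)
  obtain ⟨X, rfl⟩ := hM.exists_toRingBimodule_eq hP hQ hC hD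
  exact (X.toRingBimodule_isFaithful_iff hP hQ hC hD).trans
    (X.toRingBimodule_isUnital_iff hP hQ hC hD).symm

/-! ## The isomorphism of categories -/

theorem Bicomodule.toRingBimodule_injective (hP : P.IsDense) (hQ : Q.IsDense)
    (hC : IsLocallyProjective R C) (hD : IsLocallyProjective Rᵐᵒᵖ D) :
    Function.Injective (Bicomodule.toRingBimodule.{v} P Q) := by
  rintro ⟨V, ρ, _, l, _, _⟩ ⟨V', ρ', _, l', _, _⟩ h
  obtain rfl : V = V' := congrArg RingBimodule.toRBimodule h
  obtain ⟨-, h1, h2⟩ := RingBimodule.mk.inj h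
  obtain rfl : ρ = ρ' := BimodMap.ext fun m => hP.separates hC fun a =>
    DFunLike.congr_fun (DFunLike.congr_fun (eq_of_heq h1) m) a
  obtain rfl : l = l' := BimodMap.ext fun m => hQ.separates hD fun b =>
    DFunLike.congr_fun (DFunLike.congr_fun (eq_of_heq h2) b) m
  rfl

/-- A linear map is colinear because the two sides of each colinearity condition take the same
values at all elements of the ring, and separation applies. -/
theorem Bicomodule.toRingBimoduleFunctor_full (hP : P.IsDense) (hQ : Q.IsDense)
    (hC : IsLocallyProjective R C) (hD : IsLocallyProjective Rᵐᵒᵖ D) :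
    (Bicomodule.toRingBimoduleFunctor.{v} P Q).Full where
  map_surjective {X Y} f := by
    obtain ⟨f, h1, h2⟩ := f
    refine ⟨⟨f, fun m => hP.separates hC fun a => ?_, fun m => hQ.separates hD fun b => ?_⟩, rfl⟩
    · exact (h1 m a).symm.trans (LeftDual.eval_map (P.κ a) f.right (X.rcoact m)).symm
    · exact (h2 b m).symm.trans (RightDual.eval_map (Q.κ b) f.left (X.lcoact m)).symm

instance Bicomodule.toRingBimoduleFunctor_faithful :
    (Bicomodule.toRingBimoduleFunctor.{v} P Q).Faithful where
  map_injective h := Bicomodule.Hom.ext (congrArg RingBimodule.Hom.toMap h)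

theorem Bicomodule.exists_isoCat (hP : P.IsDense) (hQ : Q.IsDense)
    (hC : IsLocallyProjective R C) (hD : IsLocallyProjective Rᵐᵒᵖ D) :
    ∃ e : IsoCat (Bicomodule.IsCounital.{v} R D C).FullSubcategory
        (RingBimodule.IsFaithfulBirational.{v} P Q).FullSubcategory,
      e.functor ⋙ (RingBimodule.IsFaithfulBirational P Q).ι =
        (Bicomodule.IsCounital R D C).ι ⋙ Bicomodule.toRingBimoduleFunctor P Q := by
  have := Bicomodule.toRingBimoduleFunctor_full.{u, v} hP hQ hC hD
  let G : (Bicomodule.IsCounital.{v} R D C).FullSubcategory ⥤ RingBimodule.{v} R B A :=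
    (Bicomodule.IsCounital R D C).ι ⋙ Bicomodule.toRingBimoduleFunctor P Q
  have hG : G.Faithful := Functor.Faithful.comp _ _
  have hG' : G.Full := Functor.Full.comp _ _
  let F : (Bicomodule.IsCounital.{v} R D C).FullSubcategory ⥤
      (RingBimodule.IsFaithfulBirational.{v} P Q).FullSubcategory :=
    (RingBimodule.IsFaithfulBirational P Q).lift G fun X =>
      ⟨(X.obj.toRingBimodule_isFaithful_iff hP hQ hC hD).2 X.property,
        X.obj.toRingBimodule_isBirational⟩
  -- Full and faithful follow from the composite into all bimodules. On objects, injectivity is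
  -- uniqueness of the coactions and surjectivity is their existence, both as strict equalities.
  have hF : F.IsIso :=
    { faithful := Functor.Faithful.of_comp_iso (ObjectProperty.liftCompιIso _ G _)
      full := Functor.Full.of_comp_faithful_iso (ObjectProperty.liftCompιIso _ G _)
      bijective_obj := by
        refine ⟨fun X Y h => ?_, fun M => ?_⟩
        · exact ObjectProperty.FullSubcategory.ext (Bicomodule.toRingBimodule_injective hP hQ hC hD
            (congrArg ObjectProperty.FullSubcategory.obj h))
        · obtain ⟨M, hM⟩ := M
          obtain ⟨X, rfl⟩ := hM.2.exists_toRingBimodule_eq hP hQ hC hD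
          exact ⟨⟨X, (X.toRingBimodule_isFaithful_iff hP hQ hC hD).1 hM.1⟩, rfl⟩ }
  exact ⟨F.asIsomorphism, rfl⟩

end birational

theorem mainTheorem9 {R A B C D : Type u} [Ring R]
    [NonUnitalRing A] [Module R A] [Module Rᵐᵒᵖ A] [IsRRing R A]
    [NonUnitalRing B] [Module R B] [Module Rᵐᵒᵖ B] [IsRRing R B]
    [AddCommGroup C] [Module R C] [Module Rᵐᵒᵖ C] [SMulCommClass R Rᵐᵒᵖ C] [RCoring R C]
    [AddCommGroup D] [Module R D] [Module Rᵐᵒᵖ D] [SMulCommClass R Rᵐᵒᵖ D] [RCoring R D]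
    (P : MeasuringLeftPairing R A C) (Q : MeasuringRightPairing R B D)
    (hC : IsLocallyProjective R C) (hD : IsLocallyProjective Rᵐᵒᵖ D)
    (hP : P.IsDense) (hQ : Q.IsDense) :
    (∃ e : IsoCat (Bicomodule.IsCounital.{v} R D C).FullSubcategory
        (RingBimodule.IsFaithfulBirational.{v} P Q).FullSubcategory,
      e.functor ⋙ (RingBimodule.IsFaithfulBirational P Q).ι =
        (Bicomodule.IsCounital R D C).ι ⋙ Bicomodule.toRingBimoduleFunctor P Q) ∧
    RingBimodule.IsFaithfulBirational.{v} P Q = RingBimodule.IsUnitalBirational.{v} P Q ∧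
    (∃ e : IsoCat (Bicomodule.IsCounital.{v} R D C).FullSubcategory
        (RingBimodule.IsFaithfulBirational.{v} (LeftDual.pairing R C)
          (RightDual.pairing R D)).FullSubcategory,
      e.functor ⋙ (RingBimodule.IsFaithfulBirational (LeftDual.pairing R C)
          (RightDual.pairing R D)).ι =
        (Bicomodule.IsCounital R D C).ι ⋙
          Bicomodule.toRingBimoduleFunctor (LeftDual.pairing R C) (RightDual.pairing R D)) ∧
    RingBimodule.IsFaithfulBirational.{v} (LeftDual.pairing R C) (RightDual.pairing R D) =
      RingBimodule.IsUnitalBirational.{v} (LeftDual.pairing R C) (RightDual.pairing R D) := by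
  exact ⟨Bicomodule.exists_isoCat hP hQ hC hD,
    RingBimodule.isFaithfulBirational_eq_isUnitalBirational hP hQ hC hD,
    -- The evaluation pairings have the identity as `κ`, so their range is everything and density is
    -- automatic.
    Bicomodule.exists_isoCat (LeftDual.pairing_isDense R C) (RightDual.pairing_isDense R D) hC hD,
    RingBimodule.isFaithfulBirational_eq_isUnitalBirational (LeftDual.pairing_isDense R C)
      (RightDual.pairing_isDense R D) hC hD⟩
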